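/- Let $k$ be a field of characteristic zero. A $k$-variety is a reduced, separated scheme of finite type over $k$. Let $X$ be an irreducible $k$-variety. An $\mathbb{A}^1$-cylinder in $X$ over $k$ is a pair $(Z,\varphi)$ consisting of a nonempty $k$-scheme $Z$ and an open embedding $\varphi\colon Z\times\mathbb{A}^1\hookrightarrow X$ of $k$-schemes. (Such a $Z$ is automatically an irreducible $k$-variety.) It is vertically maximal in $X$ if for every generic point $\xi$ of $Z$, the morphism $\xi\times\mathbb{A}^1\to X$ induced by $\varphi$ (where $\xi$ denotes the spectrum of the residue field $\kappa(\xi)$) does not extend to a morphism $\xi\times\mathbb{P}^1\to X$ of $k$-schemes. A sub-cylinder of $(Z,\varphi)$ is an $\mathbb{A}^1$-cylinder $(Z',\varphi')$ in $X$ over $k$ for which there exist open embeddings of $k$-schemes $i\colon Z'\hookrightarrow Z$ and $j\colon Z'\times\mathbb{A}^1\hookrightarrow Z\times\mathbb{A}^1$ with $\mathrm{pr}_Z\circ j=i\circ\mathrm{pr}_{Z'}$ and $\varphi\circ j=\varphi'$. Two $\mathbb{A}^1$-cylinders in $X$ over $k$ are equivalent if they have a common sub-cylinder. An integral $k$-variety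 $Z$ is uniruled if there exist an integral $k$-variety $B$ of dimension $\dim Z-1$ and a dominant rational map $B\times\mathbb{P}^1\dashrightarrow Z$ over $k$. Proposition. If $X$ contains a vertically maximal $\mathbb{A}^1$-cylinder $(Z,\varphi)$ whose base $Z$ is not uniruled, then every $\mathbb{A}^1$-cylinder in $X$ over $k$ is equivalent to $(Z,\varphi)$. -/

import Mathlib

universe u

open CategoryTheory CategoryTheory.Limits AlgebraicGeometry

noncomputable section

namespace Cylinders

/-! ### The projective line over a scheme, and its standard affine chart -/

/-- The coordinate ring `ℤ[x₀, x₁]` of the projective line, as a ring in universe `u`. -/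
abbrev ProjCoord : Type u := MvPolynomial (Fin 2) (ULift.{u} ℤ)

/-- The grading of `ℤ[x₀, x₁]` by degree. -/
abbrev projGrading : ℕ → Submodule (ULift.{u} ℤ) ProjCoord.{u} :=
  MvPolynomial.homogeneousSubmodule (Fin 2) (ULift.{u} ℤ)

instance : GradedAlgebra projGrading.{u} := MvPolynomial.gradedAlgebra

lemma X_mem (i : Fin 2) : (MvPolynomial.X i : ProjCoord.{u}) ∈ projGrading.{u} 1 :=
  MvPolynomial.isHomogeneous_X _ _

/-- The projective line over the integers, `Proj ℤ[x₀, x₁]`. -/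
abbrev ProjLineInt : Scheme.{u} := Proj projGrading.{u}

/-- The projective line `ℙ¹ × S` over a scheme `S`. -/
def ProjLine (S : Scheme.{u}) : Scheme.{u} :=
  pullback (terminal.from S) (terminal.from ProjLineInt.{u})

/-- The projection `ℙ¹ × S ⟶ S`. -/
def ProjLine.pr (S : Scheme.{u}) : ProjLine S ⟶ S := pullback.fst _ _

/-- The affine line `S × 𝔸¹` over a scheme `S`. -/
abbrev AffLine (S : Scheme.{u}) : Scheme.{u} := AffineSpace PUnit.{u + 1} S

/-- The projection `S × 𝔸¹ ⟶ S`. -/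
abbrev AffLine.pr (S : Scheme.{u}) : AffLine S ⟶ S := AffineSpace PUnit.{u + 1} S ↘ S

/-- The dehomogenization `ℤ[x₀, x₁] ⟶ ℤ[t]`, `x₀ ↦ t`, `x₁ ↦ 1`. -/
def dehom : ProjCoord.{u} →+* MvPolynomial PUnit.{u + 1} (ULift.{u} ℤ) :=
  MvPolynomial.eval₂Hom MvPolynomial.C ![MvPolynomial.X PUnit.unit, 1]

lemma isUnit_dehom_X_one : IsUnit (dehom.{u} (MvPolynomial.X 1)) := by
  simp [dehom]

/-- The ring homomorphism `ℤ[x₀, x₁]_{(x₁)} ⟶ ℤ[t]` with `x₀ / x₁ ↦ t`. -/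
def awayDehom : HomogeneousLocalization.Away projGrading.{u} (MvPolynomial.X 1) →+*
    MvPolynomial PUnit.{u + 1} (ULift.{u} ℤ) :=
  (IsLocalization.Away.lift (S := Localization.Away (MvPolynomial.X 1 : ProjCoord.{u}))
    (MvPolynomial.X 1 : ProjCoord.{u}) isUnit_dehom_X_one).comp
    (algebraMap _ (Localization.Away (MvPolynomial.X 1 : ProjCoord.{u})))

/-- The standard chart `𝔸¹ ⟶ ℙ¹`, `t ↦ [t : 1]`, over the integers. -/
def chartInt :
    Spec (CommRingCat.of (MvPolynomial PUnit.{u + 1} (ULift.{u} ℤ))) ⟶ ProjLineInt.{u} :=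
  Spec.map (CommRingCat.ofHom awayDehom.{u}) ≫
    Proj.awayι projGrading.{u} (MvPolynomial.X 1) (m := 1)
      (X_mem.{u} 1) one_pos

/-- The standard chart `S × 𝔸¹ ⟶ S × ℙ¹`, the complement of the section at infinity. -/
def chart (S : Scheme.{u}) : AffLine S ⟶ ProjLine S :=
  pullback.lift (AffLine.pr S) (AffineSpace.toSpecMvPoly PUnit.{u + 1} S ≫ chartInt) (by simp)

@[simp]
lemma chart_pr (S : Scheme.{u}) : chart S ≫ ProjLine.pr S = AffLine.pr S :=
  pullback.lift_fst _ _ _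

lemma awayDehom_mk (n : ℕ) (a : ProjCoord.{u}) (ha : a ∈ projGrading.{u} (n • 1)) :
    awayDehom (HomogeneousLocalization.Away.mk projGrading.{u}
      (X_mem.{u} 1) n a ha) = dehom a := by
  have h1 : dehom.{u} (MvPolynomial.X 1) = 1 := by simp [dehom]
  change IsLocalization.Away.lift (S := Localization.Away (MvPolynomial.X 1 : ProjCoord.{u}))
    (MvPolynomial.X 1 : ProjCoord.{u}) isUnit_dehom_X_one
    (Localization.mk a ⟨MvPolynomial.X 1 ^ n, ⟨n, rfl⟩⟩) = dehom a
  rw [Localization.mk_eq_mk', IsLocalization.Away.lift, IsLocalization.lift_mk'_spec]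
  simp [h1]

lemma eq_zero_of_dehom_eq_zero {n : ℕ} {a : ProjCoord.{u}} (ha : a.IsHomogeneous n)
    (h : dehom a = 0) : a = 0 := by
  refine MvPolynomial.ext _ _ fun m => ?_
  rw [MvPolynomial.coeff_zero]
  by_cases hm : m.degree = n
  swap
  · exact ha.coeff_eq_zero hm
  have h1 : MvPolynomial.coeff (Finsupp.single PUnit.unit (m 0)) (dehom a) = 0 := by simp [h]
  rw [dehom, MvPolynomial.coe_eval₂Hom, MvPolynomial.eval₂_eq', MvPolynomial.coeff_sum] at h1
  rw [Finset.sum_eq_single m] at h1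
  · simpa [MvPolynomial.coeff_C_mul, MvPolynomial.coeff_X_pow] using h1
  · intro d hd hdm
    have hdn : d.degree = n := by
      by_contra hne
      exact (MvPolynomial.mem_support_iff.mp hd) (ha.coeff_eq_zero hne)
    have hne : d 0 ≠ m 0 := by
      intro h0
      apply hdm
      simp only [Finsupp.degree_eq_sum, Fin.sum_univ_two] at hdn hm
      ext i
      fin_cases i
      · exact h0
      · simp only [Fin.mk_one]; omega
    have hne' : Finsupp.single PUnit.unit (d 0) ≠ Finsupp.single PUnit.unit.{u + 1} (m 0) := by
      intro h0
      exact hne (by simpa using DFunLike.congr_fun h0 PUnit.unit)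
    simp [MvPolynomial.coeff_C_mul, MvPolynomial.coeff_X_pow, hne']
  · intro hm'
    simp [MvPolynomial.notMem_support_iff.mp hm']

lemma awayDehom_bijective : Function.Bijective awayDehom.{u} := by
  constructor
  · rw [injective_iff_map_eq_zero]
    intro x hx
    obtain ⟨n, a, ha, rfl⟩ := HomogeneousLocalization.Away.mk_surjective projGrading.{u}
      (X_mem.{u} 1) x
    rw [awayDehom_mk] at hx
    obtain rfl := eq_zero_of_dehom_eq_zero ha hx
    apply HomogeneousLocalization.val_injective
    rw [HomogeneousLocalization.val_zero]
    exact Localization.mk_zero _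
  · intro p
    change p ∈ awayDehom.{u}.rangeS
    induction p using MvPolynomial.induction_on with
    | C a =>
      have h0 : (MvPolynomial.C a : ProjCoord.{u}) ∈ projGrading.{u} (0 • 1) := by
        rw [zero_smul]
        exact MvPolynomial.isHomogeneous_C _ _
      exact ⟨_, (awayDehom_mk 0 _ h0).trans (by simp [dehom])⟩
    | add p q hp hq => exact add_mem hp hq
    | mul_X p i hp =>
      refine mul_mem hp ⟨HomogeneousLocalization.Away.mk projGrading.{u}
        (X_mem.{u} 1) 1 (MvPolynomial.X 0)
        (X_mem.{u} 0), ?_⟩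
      rw [awayDehom_mk _ _ (X_mem.{u} 0)]
      simp [dehom]

instance : IsOpenImmersion chartInt.{u} := by
  have : IsIso (CommRingCat.ofHom awayDehom.{u}) :=
    (ConcreteCategory.isIso_iff_bijective _).mpr awayDehom_bijective
  unfold chartInt
  infer_instance

instance (S : Scheme.{u}) : IsOpenImmersion (chart S) := by
  have : chart S = pullback.map (terminal.from S) (terminal.from _) (terminal.from S)
      (terminal.from ProjLineInt.{u}) (𝟙 S) chartInt (𝟙 _) (by simp) (by simp) := by
    apply pullback.hom_ext <;> simp [chart, AffineSpace.toSpecMvPoly] <;> rfl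
  rw [this]
  exact MorphismProperty.pullbackMap (P := @IsOpenImmersion)
    (inferInstanceAs (IsOpenImmersion (𝟙 S))) (inferInstanceAs (IsOpenImmersion chartInt.{u}))
    (Subsingleton.elim _ _) (Subsingleton.elim _ _)

/-! ### Varieties and uniruledness -/

/-- `p : X ⟶ Spec k` makes `X` a `k`-variety: reduced, separated and of finite type over `k`. -/
structure IsVariety {k : Type u} [Field k] {X : Scheme.{u}} (p : X ⟶ Spec (.of k)) : Prop where
  reduced : IsReduced X
  separated : IsSeparated p
  locallyOfFiniteType : LocallyOfFiniteType p
  quasiCompact : QuasiCompact p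

/-- `q : Z ⟶ Spec k` is uniruled (meant for `Z` an integral `k`-variety): there are an integral `k`-variety `B` with
`dim B = dim Z - 1` and a dominant rational map `B × ℙ¹ ⤏ Z` over `k`. -/
def IsUniruled {k : Type u} [Field k] {Z : Scheme.{u}} (q : Z ⟶ Spec (.of k)) : Prop :=
  ∃ (B : Scheme.{u}) (b : B ⟶ Spec (.of k)), IsIntegral B ∧ IsVariety b ∧
    topologicalKrullDim B + 1 = topologicalKrullDim Z ∧
    ∃ r : ProjLine B ⤏ Z, r.IsDominant ∧
      r.compHom q = (ProjLine.pr B ≫ b).toRationalMap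

/-! ### Cylinders -/

/-- An `𝔸¹`-cylinder `(Z, φ)` in `f : X ⟶ S`: a nonempty `S`-scheme `Z` and an open
embedding `φ : Z × 𝔸¹ ⟶ X` of `S`-schemes. -/
structure Cylinder {X S : Scheme.{u}} (f : X ⟶ S) where
  /-- The base of the cylinder. -/
  Z : Scheme.{u}
  /-- The structure morphism of the base. -/
  toBase : Z ⟶ S
  /-- The embedding. -/
  φ : AffLine Z ⟶ X
  nonempty : Nonempty Z
  isOpenImmersion : IsOpenImmersion φ
  comm : φ ≫ f = AffLine.pr Z ≫ toBase

namespace Cylinder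

variable {X S : Scheme.{u}} {f : X ⟶ S}

/-- `C'` is a sub-cylinder of `C`. -/
def IsSubcylinder (C' C : Cylinder f) : Prop :=
  ∃ (i : C'.Z ⟶ C.Z) (j : AffLine C'.Z ⟶ AffLine C.Z),
    IsOpenImmersion i ∧ IsOpenImmersion j ∧ i ≫ C.toBase = C'.toBase ∧
    j ≫ AffLine.pr C.Z = AffLine.pr C'.Z ≫ i ∧ j ≫ C.φ = C'.φ

/-- Two cylinders are equivalent if they have a common sub-cylinder. -/
def Equivalent (C₁ C₂ : Cylinder f) : Prop :=
  ∃ C : Cylinder f, C.IsSubcylinder C₁ ∧ C.IsSubcylinder C₂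

/-- The restriction `ξ × 𝔸¹ ⟶ X` of the embedding of a cylinder `C` to a point `ξ` of its
base; here `ξ` stands for the spectrum of its residue field. -/
def fiberMap (C : Cylinder f) (ξ : C.Z) : AffLine (Spec (C.Z.residueField ξ)) ⟶ X :=
  AffineSpace.map PUnit.{u + 1} (C.Z.fromSpecResidueField ξ) ≫ C.φ

/-- A cylinder is vertically maximal if for no generic point `ξ` of its base
`ξ × 𝔸¹ ⟶ X` extends to an `S`-morphism `ξ × ℙ¹ ⟶ X`. -/
def IsVerticallyMaximal (C : Cylinder f) : Prop :=
  ∀ ξ ∈ genericPoints C.Z,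
    ¬ ∃ g : ProjLine (Spec (C.Z.residueField ξ)) ⟶ X,
      chart _ ≫ g = C.fiberMap ξ ∧
      g ≫ f = ProjLine.pr _ ≫ C.Z.fromSpecResidueField ξ ≫ C.toBase

end Cylinder

end Cylinders

end

noncomputable section

/-! ### Dimension and transcendence degree -/

section Dimension

/-! Let L be the function field of X. Affine opens Spec A of Z and Spec R of the base of another
cylinder D give L = F(s) = F'(t), where F and F' are the fraction fields of A and R inside L and s,
t are the coordinates on the two affine lines. The proof compares F with F'.

Suppose that some e in R is transcendental over F. The affine lines of D then dominate Z in a family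
that moves with e, and a suitable divisor in e = c, for a constant c chosen in the infinite field k,
still carries a family dominating Z. Algebraically, there are a nonzero prime P of R and an
injection of A into Frac((R/P)[X]) (`exists_prime_of_transcendental`). Transcendence degrees force
dim R/P = dim A - 1, so Z is uniruled (`isUniruled_of_injective`), which is excluded. Hence R is
algebraic over F. Since F and F' are algebraically closed in L and have the same finite
transcendence degree over k, they coincide (`fractionsIn_eq_of_isAlgebraic`).

Now s and t generate L over the same field, so t = (as + b)/(cs + d). If c ≠ 0, then t takes the
finite value a/c at s = ∞, so the embedding of D supplies the missing value and the line of C over F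
extends to ℙ¹. This contradicts vertical maximality (`exists_projLine_extension`,
`not_isVerticallyMaximal`). Hence t = as + b with a ≠ 0. Over a common localization of A and R
containing a, a⁻¹ and b, the two cylinders differ by an automorphism of the affine line
(`exists_common_localization`, `equivalent_of_affine`). Separatedness of X reduces equalities of
morphisms into X to the generic point. -/

theorem ringKrullDim_eq_of_isIntegral {A B : Type*} [CommRing A] [CommRing B] [Algebra A B]
    [Algebra.IsIntegral A B] [FaithfulSMul A B] : ringKrullDim A = ringKrullDim B := by
  apply le_antisymm
  · refine iSup_le fun l => ?_
    obtain ⟨⟨P, hP, hPl⟩⟩ := Ideal.nonempty_primesOver (S := B) l.head.asIdeal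
    obtain ⟨L, hL, -⟩ := Ideal.exists_ltSeries_of_hasGoingUp l P
    rw [← hL]
    exact le_iSup (fun L : LTSeries (PrimeSpectrum B) => (L.length : WithBot ℕ∞)) L
  · refine Order.krullDim_le_of_strictMono (PrimeSpectrum.comap (algebraMap A B)) ?_
    intro p q hpq
    exact Ideal.IsIntegral.comap_lt_comap hpq

/-- Noether normalization computes both invariants: an integral injective extension of a polynomial
ring changes neither. Finiteness of n is what later permits cancellation. -/
theorem exists_ringKrullDim_eq_trdeg (k A : Type u) [Field k] [CommRing A] [IsDomain A]
    [Algebra k A] [Algebra.FiniteType k A] :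
    ∃ n : ℕ, ringKrullDim A = n ∧ Algebra.trdeg k A = n := by
  obtain ⟨s, g, hg, hgi⟩ := exists_integral_inj_algHom_of_fg k A
  refine ⟨s, ?_, ?_⟩
  · algebraize [g.toRingHom]
    have : FaithfulSMul (MvPolynomial (Fin s) k) A :=
      (faithfulSMul_iff_algebraMap_injective _ _).mpr hg
    rw [← ringKrullDim_eq_of_isIntegral (A := MvPolynomial (Fin s) k),
      MvPolynomial.ringKrullDim_of_isNoetherianRing]
    simp
  · algebraize [g.toRingHom]
    have : FaithfulSMul (MvPolynomial (Fin s) k) A :=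
      (faithfulSMul_iff_algebraMap_injective _ _).mpr hg
    have : IsScalarTower k (MvPolynomial (Fin s) k) A := .of_algHom g
    rw [← trdeg_add_eq k (MvPolynomial (Fin s) k) (A := A), trdeg_eq_zero (R := MvPolynomial (Fin s) k),
      MvPolynomial.trdeg_of_isDomain]
    simp

theorem trdeg_fractionRing (k A F : Type u) [Field k] [CommRing A] [IsDomain A] [Field F]
    [Algebra k A] [Algebra A F] [Algebra k F] [IsScalarTower k A F] [IsFractionRing A F] :
    Algebra.trdeg k F = Algebra.trdeg k A := by
  rw [← trdeg_add_eq k A (A := F)]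
  have : Algebra.IsAlgebraic A F := IsLocalization.isAlgebraic _ (nonZeroDivisors A)
  simp [trdeg_eq_zero]

theorem trdeg_polynomial (k A : Type u) [Field k] [CommRing A] [IsDomain A] [Algebra k A] :
    Algebra.trdeg k (Polynomial A) = Algebra.trdeg k A + 1 := by
  rw [← trdeg_add_eq k A (A := Polynomial A), Polynomial.trdeg_of_isDomain]

end Dimension

/-! ### Simple transcendental extensions -/

section SimpleTranscendental

open IntermediateField Polynomial

variable {K L : Type*} [Field K] [Field L] [Algebra K L]

/-- The isomorphism `K(X) ≃ L` given by a transcendental generator of `L`. -/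
def ratFuncEquivOfGenerator {s : L} (hs : Transcendental K s) (h : K⟮s⟯ = ⊤) :
    RatFunc K ≃ₐ[K] L :=
  (RatFunc.algEquivOfTranscendental s hs).trans ((equivOfEq h).trans topEquiv)

lemma ratFuncEquivOfGenerator_X {s : L} (hs : Transcendental K s) (h : K⟮s⟯ = ⊤) :
    ratFuncEquivOfGenerator hs h RatFunc.X = s := by
  simp [ratFuncEquivOfGenerator, RatFunc.algEquivOfTranscendental_X]

/-- A nonconstant rational function is transcendental, so K is algebraically closed in K(X). -/
lemma mem_range_of_isAlgebraic_of_generator {s : L} (hs : Transcendental K s) (h : K⟮s⟯ = ⊤)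
    {z : L} (hz : IsAlgebraic K z) : z ∈ (algebraMap K L).range := by
  let e := ratFuncEquivOfGenerator hs h
  have hz' : IsAlgebraic K (e.symm z) := (isAlgebraic_algHom_iff e.symm.toAlgHom e.symm.injective).mpr hz
  by_contra hn
  refine (e.symm z).transcendental_of_ne_C (fun ⟨c, hc⟩ => hn ⟨c, ?_⟩) hz'
  rw [← e.commutes, ← RatFunc.algebraMap_eq_C] at *
  rw [← hc, e.apply_symm_apply]

/-- Two generators of a simple transcendental extension differ by a fractional linear
transformation. -/
lemma exists_linearFractional_of_generators {s t : L} (hs : Transcendental K s) (h : K⟮s⟯ = ⊤)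
    (ht : K⟮t⟯ = ⊤) :
    ∃ a b c d : K, t * (algebraMap K L c * s + algebraMap K L d) =
      algebraMap K L a * s + algebraMap K L b ∧ (c ≠ 0 ∨ c = 0 ∧ d = 1 ∧ a ≠ 0) := by
  let e := ratFuncEquivOfGenerator hs h
  have hes : e RatFunc.X = s := ratFuncEquivOfGenerator_X hs h
  set f : RatFunc K := e.symm t with hf
  have hef : e f = t := e.apply_symm_apply t
  have htop : K⟮f⟯ = ⊤ := by
    have h1 : K⟮f⟯ = K⟮t⟯.map e.symm.toAlgHom := by
      rw [adjoin_map]; simp [hf]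
    rw [h1, ht, ← AlgHom.fieldRange_eq_map]
    exact AlgHom.fieldRange_eq_top.mpr e.symm.surjective
  -- The degree of K(X) over K(f) is the larger of the degrees of numerator and denominator; here it
  -- is 1.
  have hrank := RatFunc.finrank_eq_max_natDegree f
  rw [htop, IntermediateField.finrank_top] at hrank
  have hn : f.num.natDegree ≤ 1 := by omega
  have hd : f.denom.natDegree ≤ 1 := by omega
  obtain ⟨a, b, hab⟩ := Polynomial.exists_eq_X_add_C_of_natDegree_le_one hn
  obtain ⟨c, d, hcd⟩ := Polynomial.exists_eq_X_add_C_of_natDegree_le_one hd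
  have key : t * (algebraMap K L c * s + algebraMap K L d) =
      algebraMap K L a * s + algebraMap K L b := by
    have h1 : f * algebraMap K[X] _ f.denom = algebraMap K[X] _ f.num :=
      ((div_eq_iff (RatFunc.algebraMap_ne_zero f.denom_ne_zero)).mp f.num_div_denom).symm
    rw [hab, hcd] at h1
    have h2 := congrArg e h1
    simp only [map_add, map_mul, RatFunc.algebraMap_X, RatFunc.algebraMap_C, hes, hef,
      ← RatFunc.algebraMap_eq_C, e.commutes] at h2
    exact h2
  refine ⟨a, b, c, d, key, ?_⟩
  -- The denominator is monic, so c = 0 forces d = 1; then a = 0 would make f a constant, of degree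
  -- 0 instead of 1.
  by_cases hc : c = 0
  · right
    subst hc
    have hd1 : d = 1 := by
      have := f.monic_denom
      rw [hcd] at this
      simpa [Polynomial.Monic] using this
    refine ⟨rfl, hd1, ?_⟩
    rintro rfl
    rw [hab, hcd] at hrank
    simp at hrank
  · exact Or.inl hc

end SimpleTranscendental

/-! ### Specialization of a dominant family of rational curves -/

section Specialization

open Polynomial

/-- The image of a dominant morphism of finite type between integral affine schemes contains a
nonempty basic open set. -/
lemma exists_basicOpen_subset_range_comap {A B : Type*} [CommRing A] [CommRing B] [IsDomain A]
    [IsNoetherianRing A] {f : A →+* B} (hf : f.FiniteType) (hinj : Function.Injective f) :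
    ∃ h : A, h ≠ 0 ∧ (PrimeSpectrum.basicOpen h : Set (PrimeSpectrum A)) ⊆
      Set.range (PrimeSpectrum.comap f) := by
  obtain ⟨S, hS⟩ := PrimeSpectrum.exists_constructibleSetData_iff.mpr
    (PrimeSpectrum.isConstructible_range_comap (RingHom.FinitePresentation.of_finiteType.mp hf))
  have hbot : (⊥ : PrimeSpectrum A) ∈ Set.range (PrimeSpectrum.comap f) := by
    obtain ⟨p', hp', -, hp⟩ := Ideal.exists_comap_eq_of_mem_minimalPrimes (I := ⊥) f ⊥ (by
      rw [← RingHom.ker_eq_comap_bot, (RingHom.injective_iff_ker_eq_bot f).mp hinj,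
        Ideal.minimalPrimes_eq_subsingleton_self]
      rfl)
    exact ⟨⟨p', hp'⟩, PrimeSpectrum.ext hp⟩
  rw [← hS, PrimeSpectrum.ConstructibleSetData.toSet] at hbot
  obtain ⟨C, hC, hbC⟩ := Set.mem_iUnion₂.mp hbot
  -- The constructible piece through the generic point cannot impose a nontrivial equation, so it is
  -- a basic open set.
  have hg : ∀ i, C.g i = 0 := fun i => hbC.1 ⟨i, rfl⟩
  refine ⟨C.f, fun h0 => hbC.2 (by simp [h0]), fun p hp => ?_⟩
  rw [← hS, PrimeSpectrum.ConstructibleSetData.toSet]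
  refine Set.mem_iUnion₂.mpr ⟨C, hC, ?_, fun h => hp (h rfl)⟩
  rintro _ ⟨i, rfl⟩
  simp [hg i]

/-- Finitely many elements of a localization have a common denominator. -/
lemma exists_pow_mul_mem_range {k A S M : Type*} [CommRing k] [CommRing A] [CommRing S] [CommRing M]
    [Algebra k A] [Algebra k S] [Algebra k M] [Algebra.FiniteType k A] [IsDomain S]
    (ι : S →ₐ[k] M) (α : A →ₐ[k] M)
    (h : ∀ a, ∃ b c, c ≠ 0 ∧ α a * ι c = ι b) :
    ∃ g : S, g ≠ 0 ∧ ∀ a, ∃ n b, α a * ι g ^ n = ι b := by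
  classical
  obtain ⟨s, hs⟩ := Algebra.FiniteType.out (R := k) (A := A)
  choose b c hc hbc using h
  refine ⟨∏ a ∈ s, c a, Finset.prod_ne_zero_iff.mpr fun a _ => hc a, fun a => ?_⟩
  have ha : a ∈ Algebra.adjoin k (s : Set A) := hs ▸ Algebra.mem_top
  induction ha using Algebra.adjoin_induction with
  | mem a ha =>
    refine ⟨1, b a * ∏ x ∈ s.erase a, c x, ?_⟩
    rw [← Finset.mul_prod_erase s c ha, pow_one, map_mul, map_mul, ← mul_assoc, hbc]
  | algebraMap r => exact ⟨0, algebraMap k S r, by simp⟩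
  | add x y _ _ hx hy =>
    obtain ⟨n, b, hb⟩ := hx
    obtain ⟨m, b', hb'⟩ := hy
    refine ⟨n + m, b * (∏ a ∈ s, c a) ^ m + b' * (∏ a ∈ s, c a) ^ n, ?_⟩
    rw [map_add, map_add, map_mul, map_mul, ← hb, ← hb', map_pow, map_pow]
    ring
  | mul x y _ _ hx hy =>
    obtain ⟨n, b, hb⟩ := hx
    obtain ⟨m, b', hb'⟩ := hy
    refine ⟨n + m, b * b', ?_⟩
    rw [map_mul, map_mul, ← hb, ← hb']
    ring

/-- If a family of curves over `Spec R` dominates `Spec A` and moves with the parameter `e` of `R`,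
then its restriction to a suitable prime divisor of `Spec R` still dominates `Spec A`. -/
lemma exists_prime_of_transcendental {k A R L : Type u} [Field k] [Infinite k] [CommRing A]
    [IsDomain A] [Algebra k A] [Algebra.FiniteType k A] [CommRing R] [IsDomain R] [Algebra k R]
    [Algebra.FiniteType k R] [Field L] [Algebra k L] (α : A →ₐ[k] L)
    (ι : R[X] →ₐ[k] L) (hι : Function.Injective ι)
    (hfrac : ∀ z, ∃ b c, c ≠ 0 ∧ z * ι c = ι b)
    (e : R) (he : Function.Injective (eval₂ (α : A →+* L) (ι (C e)))) :
    ∃ (P : Ideal R) (_ : P.IsPrime), P ≠ ⊥ ∧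
      ∃ β : A →ₐ[k] FractionRing ((R ⧸ P)[X]), Function.Injective β := by
  -- Finitely many denominators suffice, so A maps into R[X] with a single g inverted: the rational
  -- map to Spec A is defined where g ≠ 0.
  obtain ⟨g, hg0, hg⟩ := exists_pow_mul_mem_range (k := k) ι α (fun a => hfrac (α a))
  let T := Localization.Away g
  have hιg : IsUnit (ι g) := by
    rw [isUnit_iff_ne_zero]; exact fun h => hg0 (hι (by simpa using h))
  let ιT : T →ₐ[k] L := IsLocalization.liftAlgHom (M := Submonoid.powers g) (f := ι) (by
    rintro ⟨_, n, rfl⟩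
    simpa using hιg.pow n)
  have hιT : ∀ b, ιT (algebraMap _ T b) = ι b := fun b => IsLocalization.lift_eq _ b
  have hTinj : Function.Injective (algebraMap R[X] T) :=
    IsLocalization.injective T (powers_le_nonZeroDivisors_of_noZeroDivisors hg0)
  have hιTinj : Function.Injective ιT := by
    refine (IsLocalization.lift_injective_iff _).mpr fun x y => ?_
    rw [hTinj.eq_iff]
    exact hι.eq_iff.symm
  have hrange : ∀ a, α a ∈ ιT.range := by
    intro a
    obtain ⟨n, b, hb⟩ := hg a
    refine ⟨IsLocalization.mk' T b (⟨g ^ n, n, rfl⟩ : Submonoid.powers g), ?_⟩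
    refine (IsLocalization.lift_mk'_spec _ _ _ _).mpr ?_
    change ι b = ι (g ^ n) * α a
    rw [map_pow, mul_comm, hb]
  let γ : A →ₐ[k] T := (AlgEquiv.ofInjective ιT hιTinj).symm.toAlgHom.comp
    (α.codRestrict _ hrange)
  have hγ : ∀ a, ιT (γ a) = α a := fun a =>
    congrArg Subtype.val ((AlgEquiv.ofInjective ιT hιTinj).apply_symm_apply ⟨α a, hrange a⟩)
  -- The map to Spec A together with the function e is a map to the affine line over Spec A; the
  -- injectivity of δ, inherited from `he`, makes it dominant.
  let δ : A[X] →+* T := eval₂RingHom (γ : A →+* T) (algebraMap _ T (C e))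
  have hδ : Function.Injective δ := by
    intro p q hpq
    apply he
    have := congrArg (ιT : T →+* L) hpq
    have hc : (ιT : T →+* L).comp (γ : A →+* T) = (α : A →+* L) := RingHom.ext hγ
    have hc' : (ιT : T →+* L) (algebraMap _ T (C e)) = ι (C e) := hιT _
    simp only [δ, coe_eval₂RingHom, hom_eval₂] at this
    rwa [hc, hc'] at this
  have hδk : δ.comp (algebraMap k A[X]) = algebraMap k T := by
    ext x
    simp [δ, IsScalarTower.algebraMap_apply k A A[X]]
  have hδf : δ.FiniteType := by
    refine RingHom.FiniteType.of_comp_finiteType (f := algebraMap k A[X]) ?_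
    rw [hδk, RingHom.finiteType_algebraMap]
    exact Algebra.FiniteType.trans (S := R[X]) inferInstance
      inferInstance
  have : IsNoetherianRing A := Algebra.FiniteType.isNoetherianRing k A
  obtain ⟨h, hh0, hh⟩ := exists_basicOpen_subset_range_comap hδf hδ
  -- The slice e = c must meet the open set h ≠ 0 inside the image. A nonzero h has finitely many
  -- roots in the domain A, while k is infinite.
  obtain ⟨c, hc⟩ : ∃ c : k, h.eval (algebraMap k A c) ≠ 0 := by
    by_contra! hc
    refine hh0 (Polynomial.eq_zero_of_infinite_isRoot _ (Set.Infinite.mono ?_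
      (Set.infinite_range_of_injective (algebraMap k A).injective)))
    rintro _ ⟨c, rfl⟩
    exact hc c
  -- q is the generic point of the slice e = c. A prime Q above it contains e - c and meets A in 0;
  -- P is the trace of Q on R.
  let q : Ideal A[X] := RingHom.ker (evalRingHom (algebraMap k A c))
  have hq : q.IsPrime := RingHom.ker_isPrime _
  obtain ⟨⟨Q, hQ⟩, hQq⟩ := hh (show (⟨q, hq⟩ : PrimeSpectrum A[X]) ∈ _ from hc)
  have hQq : ∀ p, δ p ∈ Q ↔ p.eval (algebraMap k A c) = 0 := fun p =>
    SetLike.ext_iff.mp (congrArg PrimeSpectrum.asIdeal hQq) p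
  let ρ : R →+* T := (algebraMap R[X] T).comp C
  let P : Ideal R := Q.comap ρ
  have hP : P.IsPrime := Ideal.comap_isPrime _ _
  refine ⟨P, hP, ?_, ?_⟩
  · intro hbot
    have h1 : δ (X - C (algebraMap k A c)) = ρ (e - algebraMap k R c) := by
      have : γ (algebraMap k A c) = ρ (algebraMap k R c) := γ.commutes c
      simp [δ, ρ, this]
    have h2 : e - algebraMap k R c ∈ P := by
      change ρ _ ∈ Q
      rw [← h1]
      exact (hQq _).mpr (by simp)
    rw [hbot, Ideal.mem_bot] at h2
    rw [h2, map_zero] at h1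
    exact X_sub_C_ne_zero _ (hδ (h1.trans (map_zero δ).symm))
  · let π : R[X] →+* (R ⧸ P)[X] := mapRingHom (Ideal.Quotient.mk P)
    let M := FractionRing ((R ⧸ P)[X])
    -- The extension of P to R[X] lands in Q. Since g becomes a unit in T it is nonzero modulo P, so
    -- T maps to Frac((R/P)[X]); the kernel on A lies in Q and hence is 0.
    have hπ : ∀ p, π p = 0 → algebraMap _ T p ∈ Q := by
      intro p hp
      have h1 : p ∈ RingHom.ker π := hp
      rw [ker_mapRingHom, Ideal.mk_ker] at h1
      refine (Ideal.map_le_iff_le_comap.mpr ?_ : P.map C ≤ Q.comap (algebraMap _ T)) h1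
      exact fun r hr => hr
    have hgM : IsUnit (((algebraMap _ M).comp π) g) := by
      rw [isUnit_iff_ne_zero, RingHom.comp_apply, Ne,
        FaithfulSMul.algebraMap_eq_zero_iff]
      intro h0
      exact hQ.ne_top (Ideal.eq_top_of_isUnit_mem _ (hπ g h0)
        (IsLocalization.Away.algebraMap_isUnit g))
    let θ : T →+* M := IsLocalization.Away.lift g hgM
    have hθ : ∀ b, θ (algebraMap _ T b) = algebraMap _ M (π b) :=
      fun b => IsLocalization.Away.lift_eq g hgM b
    have hθk : ∀ x : k, θ (γ (algebraMap k A x)) = algebraMap k M x := by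
      intro x
      rw [γ.commutes, IsScalarTower.algebraMap_apply k R[X] T, hθ,
        IsScalarTower.algebraMap_apply k (R ⧸ P)[X] M]
      congr 1
      simp [π, IsScalarTower.algebraMap_apply k R R[X],
        IsScalarTower.algebraMap_apply k (R ⧸ P) (R ⧸ P)[X]]
    refine ⟨{ θ.comp (γ : A →+* T) with commutes' := hθk }, ?_⟩
    rw [injective_iff_map_eq_zero]
    intro a ha
    have ha : θ (γ a) = 0 := ha
    obtain ⟨n, b, hb⟩ := hg a
    have h1 : γ a * algebraMap _ T g ^ n = algebraMap _ T b := by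
      apply hιTinj
      rw [map_mul, map_pow, hιT, hιT, hγ, hb]
    have h2 := congrArg θ h1
    rw [map_mul, ha, zero_mul, hθ, eq_comm, FaithfulSMul.algebraMap_eq_zero_iff] at h2
    have h3 := hπ b h2
    rw [← h1] at h3
    have h4 : γ a ∈ Q := by
      refine (hQ.mem_or_mem h3).resolve_right fun h => hQ.ne_top (Ideal.eq_top_of_isUnit_mem _ h
        ((IsLocalization.Away.algebraMap_isUnit g).pow n))
    have h5 : δ (C a) = γ a := by simp [δ]
    rw [← h5, hQq] at h4
    simpa using h4

end Specialization

/-! ### Two presentations of a field as a field of rational functions -/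

/-- `φ` identifies `L` with the field of fractions of `S`. -/
structure IsFractionMap {S L : Type*} [CommRing S] [Field L] (φ : S →+* L) : Prop where
  injective : Function.Injective φ
  exists_mul_eq : ∀ z, ∃ b c, c ≠ 0 ∧ z * φ c = φ b

lemma IsFractionMap.isFractionRing {S L : Type*} [CommRing S] [Field L] [Algebra S L]
    (h : IsFractionMap (algebraMap S L)) : IsFractionRing S L := by
  have : FaithfulSMul S L := (faithfulSMul_iff_algebraMap_injective _ _).mpr h.injective
  refine .of_field _ _ fun z => ?_
  obtain ⟨b, c, hc, hbc⟩ := h.exists_mul_eq z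
  refine ⟨b, c, ?_⟩
  rw [← hbc, mul_div_cancel_right₀]
  simpa using hc

section Dichotomy

open Polynomial IntermediateField

/-! ### The fraction field of the base inside the function field of the cylinder. -/

section Subfield

variable {k A L : Type u} [Field k] [CommRing A] [Algebra k A] [Field L] [Algebra k L]

/-- The subfield of `L` generated by the image of `A`. -/
def fractionsIn (α : A →ₐ[k] L) : IntermediateField k L := IntermediateField.adjoin k (Set.range α)

lemma mem_fractionsIn_iff (α : A →ₐ[k] L) {z : L} :
    z ∈ fractionsIn α ↔ ∃ a b, z = α a / α b := by
  rw [fractionsIn, IntermediateField.mem_adjoin_iff_div]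
  have : Algebra.adjoin k (Set.range α) = α.range := by
    rw [← AlgHom.coe_range, Algebra.adjoin_eq]
  simp [this]

lemma map_mem_fractionsIn (α : A →ₐ[k] L) (a : A) : α a ∈ fractionsIn α :=
  IntermediateField.subset_adjoin _ _ ⟨a, rfl⟩

/-- The subfield of `L` generated by `A` as an `A`-algebra. -/
abbrev fractionsInAlgebra (α : A →ₐ[k] L) : Algebra A (fractionsIn α) :=
  (α.codRestrict (fractionsIn α).toSubalgebra (map_mem_fractionsIn α)).toRingHom.toAlgebra

lemma isFractionRing_fractionsIn {α : A →ₐ[k] L} (hα : Function.Injective α) :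
    letI := fractionsInAlgebra α
    IsFractionRing A (fractionsIn α) := by
  let := fractionsInAlgebra α
  have : FaithfulSMul A (fractionsIn α) := (faithfulSMul_iff_algebraMap_injective _ _).mpr
    fun a b hab => hα (congrArg Subtype.val hab)
  refine .of_field _ _ fun z => ?_
  obtain ⟨a, b, hab⟩ := (mem_fractionsIn_iff α).mp z.2
  exact ⟨a, b, Subtype.ext hab⟩

/-- The restriction of `φ` to the constant polynomials. -/
abbrev constHom (φ : A[X] →ₐ[k] L) : A →ₐ[k] L := φ.comp CAlgHom

lemma constHom_injective {φ : A[X] →ₐ[k] L} (h : Function.Injective φ) :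
    Function.Injective (constHom φ) := h.comp C_injective

lemma eval₂_constHom (φ : A[X] →ₐ[k] L) (p : A[X]) :
    eval₂ (constHom φ : A →+* L) (φ X) p = φ p := by
  have : eval₂RingHom (constHom φ : A →+* L) (φ X) = (φ : A[X] →+* L) := by
    ext <;> simp
  exact congrArg (fun f : A[X] →+* L => f p) this

variable {φ : A[X] →ₐ[k] L} (h : IsFractionMap (φ : A[X] →+* L))

include h in
-- Clearing denominators turns an algebraic relation over Frac A into one over A, which the
-- injectivity of φ rules out.
lemma transcendental_X [IsDomain A] : Transcendental (fractionsIn (constHom φ)) (φ X) := by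
  let := fractionsInAlgebra (constHom φ)
  let : Algebra A L := (constHom φ).toRingHom.toAlgebra
  have : IsScalarTower A (fractionsIn (constHom φ)) L := .of_algebraMap_eq fun _ => rfl
  have := isFractionRing_fractionsIn (constHom_injective h.injective)
  rw [Transcendental, ← IsFractionRing.isAlgebraic_iff A]
  change Transcendental _ _
  rw [transcendental_iff_injective]
  intro p q hpq
  refine h.injective ?_
  change φ p = φ q
  rw [← eval₂_constHom φ p, ← eval₂_constHom φ q]
  exact hpq

include h in
lemma adjoin_X_eq_top : (fractionsIn (constHom φ))⟮φ X⟯ = ⊤ := by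
  have key : ∀ p, φ p ∈ (fractionsIn (constHom φ))⟮φ X⟯ := by
    intro p
    rw [← eval₂_constHom φ p, eval₂_eq_sum]
    refine sum_mem fun i _ => mul_mem ?_ (pow_mem (mem_adjoin_simple_self _ _) i)
    exact IntermediateField.algebraMap_mem _ (⟨_, map_mem_fractionsIn _ _⟩ : fractionsIn (constHom φ))
  refine eq_top_iff.mpr fun z _ => ?_
  obtain ⟨b, c, hc, hbc⟩ := h.exists_mul_eq z
  have hc' : φ c ≠ 0 := fun h0 => hc (h.injective (h0.trans (map_zero φ).symm))
  rw [← mul_div_cancel_right₀ z hc']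
  exact div_mem (hbc ▸ key b) (key c)

include h in
lemma mem_fractionsIn_of_isAlgebraic [IsDomain A] {z : L} (hz : IsAlgebraic (fractionsIn (constHom φ)) z) :
    z ∈ fractionsIn (constHom φ) := by
  obtain ⟨y, rfl⟩ := mem_range_of_isAlgebraic_of_generator (transcendental_X h)
    (adjoin_X_eq_top h) hz
  exact y.2

include h in
lemma trdeg_eq_add_one [IsDomain A] : Algebra.trdeg k L = Algebra.trdeg k A + 1 := by
  let := φ.toRingHom.toAlgebra
  have : IsFractionRing A[X] L := IsFractionMap.isFractionRing h
  have : IsScalarTower k A[X] L := .of_algHom φ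
  rw [trdeg_fractionRing k A[X] L, trdeg_polynomial]

end Subfield

variable {k A R L : Type u} [Field k] [CommRing A] [Algebra k A] [IsDomain A]
  [CommRing R] [IsDomain R] [Algebra k R] [Field L] [Algebra k L]
  {φ : A[X] →ₐ[k] L} {ψ : R[X] →ₐ[k] L}

lemma trdeg_fractionsIn {α : A →ₐ[k] L} (hα : Function.Injective α) :
    Algebra.trdeg k (fractionsIn α) = Algebra.trdeg k A := by
  let := fractionsInAlgebra α
  have := isFractionRing_fractionsIn hα
  have : IsScalarTower k A (fractionsIn α) :=
    .of_algHom (α.codRestrict (fractionsIn α).toSubalgebra (map_mem_fractionsIn α))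
  exact trdeg_fractionRing k A _

/-- Each of the two fields is algebraically closed in L. Algebraicity of R gives one inclusion;
equality of transcendence degrees makes that inclusion algebraic, which gives the other. -/
theorem fractionsIn_eq_of_isAlgebraic [Algebra.FiniteType k A]
    (hφ : IsFractionMap (φ : A[X] →+* L)) (hψ : IsFractionMap (ψ : R[X] →+* L))
    (halg : ∀ r, IsAlgebraic (fractionsIn (constHom φ)) (ψ (C r))) :
    fractionsIn (constHom φ) = fractionsIn (constHom ψ) := by
  have hle : fractionsIn (constHom ψ) ≤ fractionsIn (constHom φ) := by
    refine adjoin_le_iff.mpr ?_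
    rintro _ ⟨r, rfl⟩
    exact mem_fractionsIn_of_isAlgebraic hφ (halg r)
  refine le_antisymm (fun z hz => mem_fractionsIn_of_isAlgebraic hψ ?_) hle
  obtain ⟨n, -, hn⟩ := exists_ringKrullDim_eq_trdeg k A
  have h1 := trdeg_eq_add_one hφ
  rw [trdeg_eq_add_one hψ, Cardinal.add_one_inj] at h1
  let : Algebra (fractionsIn (constHom ψ)) (fractionsIn (constHom φ)) :=
    (inclusion hle).toRingHom.toAlgebra
  have : IsScalarTower k (fractionsIn (constHom ψ)) (fractionsIn (constHom φ)) :=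
    .of_algHom (inclusion hle)
  have : FaithfulSMul (fractionsIn (constHom ψ)) (fractionsIn (constHom φ)) :=
    (faithfulSMul_iff_algebraMap_injective _ _).mpr (inclusion hle).injective
  have h2 := trdeg_add_eq k (fractionsIn (constHom ψ)) (A := fractionsIn (constHom φ))
  rw [trdeg_fractionsIn (constHom_injective hφ.injective),
    trdeg_fractionsIn (constHom_injective hψ.injective), h1, hn] at h2
  have h3 : Algebra.trdeg (fractionsIn (constHom ψ)) (fractionsIn (constHom φ)) = 0 := by
    -- Cardinal cancellation is valid because n is finite.
    refine Cardinal.eq_of_add_eq_add_left (a := (n : Cardinal)) (by simpa using h2) ?_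
    exact Cardinal.natCast_lt_aleph0
  rw [trdeg_eq_zero_iff] at h3
  have : IsScalarTower (fractionsIn (constHom ψ)) (fractionsIn (constHom φ)) L :=
    .of_algebraMap_eq fun _ => rfl
  exact (Algebra.IsAlgebraic.isAlgebraic (R := fractionsIn (constHom ψ))
    (⟨z, hz⟩ : fractionsIn (constHom φ))).algebraMap

/-- Either the function fields of the bases of two cylinders agree, or a divisor of the second base
gives rise to a ruling of the first base. -/
theorem fractionsIn_eq_or_exists_prime [Infinite k] [Algebra.FiniteType k A]
    [Algebra.FiniteType k R] (hφ : IsFractionMap (φ : A[X] →+* L))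
    (hψ : IsFractionMap (ψ : R[X] →+* L)) :
    fractionsIn (constHom φ) = fractionsIn (constHom ψ) ∨
      ∃ (P : Ideal R) (_ : P.IsPrime), ringKrullDim (R ⧸ P) + 1 = ringKrullDim A ∧
        ∃ β : A →ₐ[k] FractionRing ((R ⧸ P)[X]), Function.Injective β := by
  by_cases halg : ∀ r, IsAlgebraic (fractionsIn (constHom φ)) (ψ (C r))
  · exact .inl (fractionsIn_eq_of_isAlgebraic hφ hψ halg)
  right
  push Not at halg
  obtain ⟨r, hr⟩ := halg
  have hr' : Function.Injective (eval₂ (constHom φ : A →+* L) (ψ (C r))) := by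
    let := fractionsInAlgebra (constHom φ)
    let : Algebra A L := (constHom φ).toRingHom.toAlgebra
    have : IsScalarTower A (fractionsIn (constHom φ)) L := .of_algebraMap_eq fun _ => rfl
    have := isFractionRing_fractionsIn (constHom_injective hφ.injective)
    rw [← IsFractionRing.isAlgebraic_iff A] at hr
    exact transcendental_iff_injective.mp hr
  obtain ⟨P, hP, hPbot, β, hβ⟩ := exists_prime_of_transcendental (constHom φ) ψ hψ.injective
    hψ.exists_mul_eq r hr'
  refine ⟨P, hP, ?_, β, hβ⟩
  obtain ⟨n, hn, hn'⟩ := exists_ringKrullDim_eq_trdeg k A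
  obtain ⟨m, hm, hm'⟩ := exists_ringKrullDim_eq_trdeg k R
  obtain ⟨l, hl, hl'⟩ := exists_ringKrullDim_eq_trdeg k (R ⧸ P)
  have h1 := trdeg_eq_add_one hφ
  rw [trdeg_eq_add_one hψ, Cardinal.add_one_inj, hn', hm', Nat.cast_inj] at h1
  -- A nonzero prime lowers the dimension by at least one; the injection β shows, through
  -- transcendence degrees, that it lowers it by at most one.
  have h2 : l + 1 ≤ m := by
    obtain ⟨x, hxP, hx⟩ := Submodule.exists_mem_ne_zero_of_ne_bot hPbot
    have := ringKrullDim_succ_le_of_surjective (Ideal.Quotient.mk P) Ideal.Quotient.mk_surjective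
      (mem_nonZeroDivisors_of_ne_zero hx) (Ideal.Quotient.eq_zero_iff_mem.mpr hxP)
    rw [hl, hm] at this
    exact_mod_cast this
  have h3 : n ≤ l + 1 := by
    have := trdeg_le_of_injective β hβ
    rw [trdeg_fractionRing k ((R ⧸ P)[X]), trdeg_polynomial, hn', hl'] at this
    exact_mod_cast this
  rw [hl, hn]
  norm_cast
  omega

end Dichotomy

/-! ### Common localizations of birational algebras -/

section CommonLocalization

/-- A birational extension `A → B` of finite type becomes an open immersion after
localizing `B` at a multiple of a suitable element of `A`. -/
lemma exists_isStandardOpenImmersion {A B : Type*} [CommRing A] [CommRing B] [IsDomain A]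
    [IsDomain B] [Algebra A B] [Algebra.FiniteType A B] [FaithfulSMul A B]
    (h : ∀ b : B, ∃ a c : A, c ≠ 0 ∧ b * algebraMap A B c = algebraMap A B a) :
    ∃ f : A, f ≠ 0 ∧ ∀ c : B, c ≠ 0 → algebraMap A B f ∣ c → ∀ (T : Type _) [CommRing T]
      [Algebra B T] [Algebra A T] [IsScalarTower A B T] [IsLocalization.Away c T],
      Algebra.IsStandardOpenImmersion A T := by
  obtain ⟨f, hf0, hf⟩ := exists_pow_mul_mem_range (k := A) (Algebra.ofId A B) (AlgHom.id A B) h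
  have hinj := FaithfulSMul.algebraMap_injective A B
  refine ⟨f, hf0, fun c hc hd T _ _ _ _ _ => ?_⟩
  have hBT : Function.Injective (algebraMap B T) :=
    IsLocalization.injective T (powers_le_nonZeroDivisors_of_noZeroDivisors hc)
  have hAT : ∀ x, algebraMap A T x = algebraMap B T (algebraMap A B x) :=
    IsScalarTower.algebraMap_apply A B T
  have hf : ∀ b : B, ∃ n a, b * algebraMap A B f ^ n = algebraMap A B a := hf
  obtain ⟨m, a, ha⟩ := hf c
  have hcu : IsUnit (algebraMap B T c) := IsLocalization.Away.algebraMap_isUnit c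
  have hfu : IsUnit (algebraMap A T f) := by
    rw [hAT]
    exact isUnit_of_dvd_unit (map_dvd _ hd) hcu
  have hau : IsUnit (algebraMap A T a) := by
    rw [hAT, ← ha, map_mul, map_pow, ← hAT]
    exact hcu.mul (hfu.pow m)
  -- As c f^m = a, and f divides c, inverting c in B is the same as inverting f a in A.
  refine ⟨f * a, (isLocalization_iff _ _).mpr ⟨?_, ?_, ?_⟩⟩
  · rintro ⟨_, n, rfl⟩
    rw [map_pow, map_mul]
    exact (hfu.mul hau).pow n
  · intro z
    obtain ⟨⟨b, _, n, rfl⟩, hb⟩ := IsLocalization.surj (Submonoid.powers c) z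
    obtain ⟨j, a', ha'⟩ := hf b
    refine ⟨⟨a' * f ^ (m * n) * f ^ n * a ^ j, (f * a) ^ (n + j), n + j, rfl⟩, ?_⟩
    have hb : z * algebraMap B T c ^ n = algebraMap B T b := by simpa using hb
    have h1 := congrArg (algebraMap B T) ha
    have h2 := congrArg (algebraMap B T) ha'
    simp only [map_mul, map_pow, ← hAT] at h1 h2 ⊢
    rw [← h2, ← hb, ← h1]
    ring
  · intro x y hxy
    rw [hAT, hAT] at hxy
    exact ⟨1, congrArg _ (hinj (hBT hxy))⟩

/-- Two finitely generated subalgebras of a field with the same field of fractions have a common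
localization, which may be chosen to contain finitely many given fractions. -/
lemma exists_common_localization {k A R L : Type u} [Field k] [CommRing A] [CommRing R]
    [Algebra k A] [Algebra k R] [IsDomain A] [IsDomain R] [Field L] [Algebra k L]
    [Algebra.FiniteType k A] [Algebra.FiniteType k R] (α : A →ₐ[k] L) (ρ : R →ₐ[k] L)
    (hα : Function.Injective α) (hρ : Function.Injective ρ) (h : fractionsIn α = fractionsIn ρ)
    (s : Finset L) (hs : (s : Set L) ⊆ fractionsIn α) :
    ∃ (B : Type u) (_ : CommRing B) (_ : IsDomain B) (_ : Algebra k B) (ι : B →ₐ[k] L)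
      (α' : A →ₐ[k] B) (ρ' : R →ₐ[k] B), Function.Injective ι ∧ ι.comp α' = α ∧ ι.comp ρ' = ρ ∧
      α'.toRingHom.IsStandardOpenImmersion ∧ ρ'.toRingHom.IsStandardOpenImmersion ∧
      (s : Set L) ⊆ ι.range := by
  -- Generated by A, R and the prescribed fractions, this is of finite type and birational to both A
  -- and R.
  let B₀ : Subalgebra k L := α.range ⊔ ρ.range ⊔ Algebra.adjoin k s
  have hαB : ∀ a, α a ∈ B₀ := fun a =>
    (le_sup_left.trans le_sup_left : α.range ≤ B₀) (AlgHom.mem_range_self α a)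
  have hρB : ∀ a, ρ a ∈ B₀ := fun a =>
    (le_sup_right.trans le_sup_left : ρ.range ≤ B₀) (AlgHom.mem_range_self ρ a)
  have hle : B₀ ≤ (fractionsIn α).toSubalgebra := by
    refine sup_le (sup_le ?_ ?_) (Algebra.adjoin_le hs)
    · rintro _ ⟨a, rfl⟩
      exact map_mem_fractionsIn α a
    · rintro _ ⟨a, rfl⟩
      rw [h]
      exact map_mem_fractionsIn ρ a
  have hfg : B₀.FG := by
    refine (Subalgebra.FG.sup (Subalgebra.FG.sup ?_ ?_) (Subalgebra.fg_adjoin_finset s))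
    · rw [← Algebra.map_top]
      exact Subalgebra.FG.map _ Algebra.FiniteType.out
    · rw [← Algebra.map_top]
      exact Subalgebra.FG.map _ Algebra.FiniteType.out
  have : Algebra.FiniteType k B₀ := Subalgebra.fg_iff_finiteType _ |>.mp hfg
  -- Allowing every multiple c of f lets the product of the elements found for A and for R serve
  -- both.
  have key : ∀ {S : Type u} [CommRing S] [Algebra k S] [IsDomain S] (σ : S →ₐ[k] L)
      (hσ : Function.Injective σ) (hσB : ∀ a, σ a ∈ B₀) (h' : fractionsIn α = fractionsIn σ),
      ∃ f : B₀, f ≠ 0 ∧ ∀ c : B₀, c ≠ 0 → f ∣ c →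
        ((algebraMap B₀ (Localization.Away c)).comp
          (σ.codRestrict B₀ hσB).toRingHom).IsStandardOpenImmersion := by
    intro S _ _ _ σ hσ hσB h'
    let σ' := σ.codRestrict B₀ hσB
    let := σ'.toRingHom.toAlgebra
    have : IsScalarTower k S B₀ := .of_algHom σ'
    have : Algebra.FiniteType S B₀ := .of_restrictScalars_finiteType k S B₀
    have hinj : Function.Injective (algebraMap S B₀) :=
      fun x y hxy => hσ (congrArg Subtype.val hxy)
    have : FaithfulSMul S B₀ := (faithfulSMul_iff_algebraMap_injective _ _).mpr hinj
    obtain ⟨f, hf0, hf⟩ := exists_isStandardOpenImmersion (A := S) (B := B₀) fun b => by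
      obtain ⟨x, y, hxy⟩ := (mem_fractionsIn_iff σ).mp (h' ▸ hle b.2)
      by_cases hy : y = 0
      · refine ⟨0, 1, one_ne_zero, Subtype.ext ?_⟩
        simpa [hy] using hxy
      · refine ⟨x, y, hy, Subtype.ext ?_⟩
        change (b : L) * σ y = σ x
        rw [hxy, div_mul_cancel₀]
        exact fun h0 => hy (hσ (h0.trans (map_zero σ).symm))
    refine ⟨algebraMap S B₀ f, fun h0 => hf0 (hinj (h0.trans (map_zero _).symm)),
      fun c hc hfc => ?_⟩
    exact RingHom.isStandardOpenImmersion_algebraMap.mpr (hf c hc hfc (Localization.Away c))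
  obtain ⟨f, hf0, hf⟩ := key α hα hαB rfl
  obtain ⟨g, hg0, hg⟩ := key ρ hρ hρB h
  have hfg0 : f * g ≠ 0 := mul_ne_zero hf0 hg0
  let T := Localization.Away (f * g)
  have hunit : ∀ y : Submonoid.powers (f * g), IsUnit (B₀.val y) := by
    rintro ⟨_, n, rfl⟩
    rw [isUnit_iff_ne_zero]
    exact fun h0 => pow_ne_zero n hfg0 (Subtype.ext h0)
  let ι : T →ₐ[k] L := IsLocalization.liftAlgHom (f := B₀.val) hunit
  have hι : ∀ b, ι (algebraMap B₀ T b) = b := fun b => IsLocalization.lift_eq _ b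
  refine ⟨T, inferInstance, IsLocalization.Away.isDomain (Localization.Away (f * g)) hfg0,
    inferInstance, ι, (IsScalarTower.toAlgHom k B₀ T).comp (α.codRestrict B₀ hαB),
    (IsScalarTower.toAlgHom k B₀ T).comp (ρ.codRestrict B₀ hρB), ?_, ?_, ?_,
    hf _ hfg0 ⟨g, rfl⟩, hg _ hfg0 ⟨f, mul_comm _ _⟩, ?_⟩
  · refine (IsLocalization.lift_injective_iff _).mpr fun x y => ?_
    rw [(IsLocalization.injective T
      (powers_le_nonZeroDivisors_of_noZeroDivisors hfg0)).eq_iff]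
    exact Subtype.val_injective.eq_iff.symm
  · ext a
    exact hι ⟨α a, hαB a⟩
  · ext a
    exact hι ⟨ρ a, hρB a⟩
  · intro x hx
    have hxB : x ∈ B₀ := (le_sup_right : _ ≤ B₀) (Algebra.subset_adjoin hx)
    exact ⟨algebraMap B₀ T ⟨x, hxB⟩, hι _⟩

end CommonLocalization

/-! ### Schemes covered by two open subschemes -/

section TwoCover

variable {P U₁ U₂ W X : Scheme.{u}} (i₁ : U₁ ⟶ P) (i₂ : U₂ ⟶ P)
  [IsOpenImmersion i₁] [IsOpenImmersion i₂]

/-- The open cover given by two jointly surjective open immersions. -/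
def twoOpenCover (hcov : ∀ x, x ∈ Set.range i₁ ∨ x ∈ Set.range i₂) : P.OpenCover :=
  .mkOfCovers Bool (fun b => bif b then U₁ else U₂)
    (fun b => match b with
      | true => i₁
      | false => i₂)
    (fun x => (hcov x).elim (fun ⟨y, hy⟩ => ⟨true, y, hy⟩) (fun ⟨y, hy⟩ => ⟨false, y, hy⟩))
    (fun b => match b with
      | true => ‹IsOpenImmersion i₁›
      | false => ‹IsOpenImmersion i₂›)

variable {i₁ i₂}

/-- W is dense in the overlap, so two morphisms from the reduced overlap to the separated X agree
once they agree on W. In the application W is a generic point. -/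
theorem exists_glue_of_separated [X.IsSeparated] [IsReduced P] {f₁ : U₁ ⟶ X} {f₂ : U₂ ⟶ X}
    (hcov : ∀ x, x ∈ Set.range i₁ ∨ x ∈ Set.range i₂) {w₁ : W ⟶ U₁} {w₂ : W ⟶ U₂}
    (hw : w₁ ≫ i₁ = w₂ ≫ i₂) (hf : w₁ ≫ f₁ = w₂ ≫ f₂) [IsDominant (w₁ ≫ i₁)] :
    ∃ g : P ⟶ X, i₁ ≫ g = f₁ ∧ i₂ ≫ g = f₂ := by
  have key : pullback.fst i₁ i₂ ≫ f₁ = pullback.snd i₁ i₂ ≫ f₂ := by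
    have : IsReduced (pullback i₁ i₂) :=
      isReduced_of_isOpenImmersion (pullback.fst i₁ i₂ ≫ i₁)
    have : IsDominant (pullback.lift w₁ w₂ hw ≫ pullback.fst i₁ i₂ ≫ i₁) := by
      rwa [pullback.lift_fst_assoc]
    have : IsDominant (pullback.lift w₁ w₂ hw) :=
      IsDominant.of_comp_of_isOpenImmersion _ (pullback.fst i₁ i₂ ≫ i₁)
    exact ext_of_isDominant (pullback.lift w₁ w₂ hw) (by
      rw [pullback.lift_fst_assoc, pullback.lift_snd_assoc, hf])
  let 𝒰 := twoOpenCover i₁ i₂ hcov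
  let f : ∀ b, 𝒰.X b ⟶ X := fun b => match b with
    | true => f₁
    | false => f₂
  have hcomp : ∀ x y, pullback.fst (𝒰.f x) (𝒰.f y) ≫ f x = pullback.snd (𝒰.f x) (𝒰.f y) ≫ f y := by
    rintro (_ | _) (_ | _)
    · have : pullback.fst i₂ i₂ = pullback.snd i₂ i₂ := by
        rw [← cancel_mono i₂, pullback.condition]
      exact congrArg (· ≫ f₂) this
    · have := congrArg ((pullbackSymmetry i₂ i₁).hom ≫ ·) key
      simp only [pullbackSymmetry_hom_comp_fst_assoc, pullbackSymmetry_hom_comp_snd_assoc] at this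
      exact this.symm
    · exact key
    · have : pullback.fst i₁ i₁ = pullback.snd i₁ i₁ := by
        rw [← cancel_mono i₁, pullback.condition]
      exact congrArg (· ≫ f₁) this
  exact ⟨𝒰.glueMorphisms f hcomp, 𝒰.ι_glueMorphisms f hcomp true, 𝒰.ι_glueMorphisms f hcomp false⟩

/-- A point of W lies in the overlap, so the overlap is dense in the irreducible U₂ and U₁ is dense
in P. -/
theorem isIntegral_of_two_cover [IsIntegral U₁] [IsIntegral U₂]
    (hcov : ∀ x, x ∈ Set.range i₁ ∨ x ∈ Set.range i₂) {w₁ : W ⟶ U₁} {w₂ : W ⟶ U₂} [Nonempty W]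
    (hw : w₁ ≫ i₁ = w₂ ≫ i₂) : IsIntegral P := by
  have : IsReduced P := by
    have : ∀ b, IsReduced ((twoOpenCover i₁ i₂ hcov).X b) := by
      rintro (_ | _)
      · exact inferInstanceAs (IsReduced U₂)
      · exact inferInstanceAs (IsReduced U₁)
    exact IsReduced.of_openCover _ (twoOpenCover i₁ i₂ hcov)
  obtain ⟨z⟩ := ‹Nonempty W›
  have hdense : DenseRange i₁ := by
    intro x
    rcases hcov x with hx | ⟨y, rfl⟩
    · exact subset_closure hx
    · have h1 : Dense (i₂ ⁻¹' Set.range i₁) := by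
        refine (i₁.isOpenEmbedding.isOpen_range.preimage i₂.continuous).dense
          ⟨w₂ z, w₁ z, ?_⟩
        rw [← Scheme.Hom.comp_apply, hw, Scheme.Hom.comp_apply]
      have h2 := image_closure_subset_closure_image i₂.continuous ⟨y, h1 y, rfl⟩
      exact closure_mono (Set.image_preimage_subset _ _) h2
  have : IrreducibleSpace P := by
    have h1 : IsIrreducible (Set.range i₁) := by
      rw [← Set.image_univ]
      exact (IrreducibleSpace.isIrreducible_univ U₁).image _ i₁.continuous.continuousOn
    have h2 := h1.closure
    rw [hdense.closure_range] at h2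
    have : PreirreducibleSpace P := ⟨h2.2⟩
    exact ⟨⟨w₁ z |> i₁⟩⟩
  exact isIntegral_of_irreducibleSpace_of_isReduced P

end TwoCover

/-! ### The generic point of an integral scheme -/

section GenericPoint

lemma isDominant_specMap {A B : Type u} [CommRing A] [CommRing B] [IsReduced A] (f : A →+* B)
    (hf : Function.Injective f) : IsDominant (Spec.map (CommRingCat.ofHom f)) := by
  refine ⟨(PrimeSpectrum.denseRange_comap_iff_ker_le_nilRadical f).mpr ?_⟩
  rw [(RingHom.injective_iff_ker_eq_bot f).mp hf]
  exact bot_le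

lemma isDominant_of_isOpenImmersion {U X : Scheme.{u}} [IrreducibleSpace X] [Nonempty U]
    (i : U ⟶ X) [IsOpenImmersion i] : IsDominant i :=
  ⟨i.isOpenEmbedding.isOpen_range.dense (Set.range_nonempty i)⟩

/-- Every affine open subscheme of an integral scheme has the same function field. -/
theorem exists_isFractionMap {X : Scheme.{u}} [IsIntegral X] {S : Type u} [CommRing S]
    [IsDomain S] (ι : Spec (.of S) ⟶ X) [IsOpenImmersion ι] :
    ∃ φ : S →+* X.functionField, IsFractionMap φ ∧
      Spec.map (CommRingCat.ofHom φ) ≫ ι = X.fromSpecStalk (genericPoint X) := by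
  have hU := isAffineOpen_opensRange ι
  have : Nonempty ι.opensRange := ⟨⟨_, ⟨Classical.arbitrary _, rfl⟩⟩⟩
  have hfrac := functionField_isFractionRing_of_isAffineOpen X ι.opensRange hU
  have hη : genericPoint X ∈ ι.opensRange :=
    ((genericPoint_spec X).mem_open_set_iff ι.opensRange.isOpen).mpr (by simpa using this)
  let e : Spec (.of S) ≅ Spec Γ(X, ι.opensRange) :=
    IsOpenImmersion.isoOfRangeEq ι hU.fromSpec (by rw [hU.range_fromSpec]; rfl)
  have he : e.inv ≫ ι = hU.fromSpec := IsOpenImmersion.isoOfRangeEq_inv_fac _ _ _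
  let ε : CommRingCat.of S ⟶ Γ(X, ι.opensRange) := Spec.preimage e.inv
  have hε : Spec.map ε = e.inv := Spec.map_preimage _
  have : IsIso (Spec.map ε) := by
    rw [hε]
    infer_instance
  have hεb : Function.Bijective ε.hom := isIso_SpecMap_iff.mp this
  refine ⟨(X.germToFunctionField ι.opensRange).hom.comp ε.hom, ⟨?_, ?_⟩, ?_⟩
  · exact (IsFractionRing.injective Γ(X, ι.opensRange) X.functionField).comp hεb.1
  · intro z
    obtain ⟨⟨b, c⟩, hbc⟩ := IsLocalization.surj (nonZeroDivisors Γ(X, ι.opensRange)) z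
    obtain ⟨b', rfl⟩ := hεb.2 b
    obtain ⟨c', hc'⟩ := hεb.2 c
    refine ⟨b', c', ?_, ?_⟩
    · rintro rfl
      exact nonZeroDivisors.ne_zero c.2 (hc'.symm.trans (map_zero ε.hom))
    · rw [← hc'] at hbc
      exact hbc
  · rw [← hU.fromSpecStalk_eq_fromSpecStalk hη, IsAffineOpen.fromSpecStalk, ← he, ← hε,
      CommRingCat.ofHom_comp, Spec.map_comp, Category.assoc]
    rfl

end GenericPoint

/-! ### The affine line over an affine scheme -/

section AffineLine

open Polynomial Cylinders

/-- The ring homomorphism `ℤ[t] → M` with `t ↦ s`. -/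
def evalInt {M : Type u} [CommRing M] (s : M) :
    MvPolynomial PUnit.{u + 1} (ULift.{u} ℤ) →+* M :=
  MvPolynomial.eval₂Hom ((Int.castRingHom M).comp ULift.ringEquiv.toRingHom) fun _ => s

lemma evalInt_X {M : Type u} [CommRing M] (s : M) (i) : evalInt s (MvPolynomial.X i) = s := by
  simp [evalInt]

lemma comp_evalInt {M N : Type u} [CommRing M] [CommRing N] (f : M →+* N) (s : M) :
    f.comp (evalInt s) = evalInt (f s) := by
  apply MvPolynomial.ringHom_ext
  · intro r
    exact RingHom.congr_fun (RingHom.ext_int ((f.comp (evalInt s)).comp (MvPolynomial.C.comp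
      ULift.ringEquiv.symm.toRingHom)) ((evalInt (f s)).comp (MvPolynomial.C.comp
      ULift.ringEquiv.symm.toRingHom))) r.down
  · intro i
    simp [evalInt_X]

/-- The affine line over `Spec R` is `Spec R[X]`. -/
def affSpec (R : Type u) [CommRing R] : Spec (.of R[X]) ≅ AffLine (Spec (.of R)) :=
  (Scheme.Spec.mapIso
    (MvPolynomial.uniqueAlgEquiv R PUnit.{u + 1}).toRingEquiv.toCommRingCatIso.op) ≪≫
    (AffineSpace.SpecIso PUnit.{u + 1} (.of R)).symm

lemma affLine_hom_ext {S W : Scheme.{u}} {f g : W ⟶ AffLine S}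
    (h₁ : f ≫ AffLine.pr S = g ≫ AffLine.pr S)
    (h₂ : f ≫ AffineSpace.toSpecMvPoly _ S = g ≫ AffineSpace.toSpecMvPoly _ S) : f = g :=
  pullback.hom_ext h₁ h₂

@[simp]
lemma affSpec_hom_pr (R : Type u) [CommRing R] :
    (affSpec R).hom ≫ AffLine.pr _ = Spec.map (CommRingCat.ofHom C) := by
  simp only [affSpec, Iso.trans_hom, Iso.symm_hom, Category.assoc, AffLine.pr,
    AffineSpace.SpecIso_inv_over, Functor.mapIso_hom, Iso.op_hom, Scheme.Spec_map,
    Quiver.Hom.unop_op, ← Spec.map_comp]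
  congr 1
  ext x
  simp

@[simp]
lemma affSpec_hom_toSpecMvPoly (R : Type u) [CommRing R] :
    (affSpec R).hom ≫ AffineSpace.toSpecMvPoly _ _ =
      Spec.map (CommRingCat.ofHom (evalInt (X : R[X]))) := by
  apply (AffineSpace.toSpecMvPolyIntEquiv _).injective
  ext i
  have h : (affSpec R).hom.appTop (AffineSpace.coord (Spec (.of R)) i) =
      (Scheme.ΓSpecIso (.of R[X])).inv X := by
    simp only [affSpec, Iso.trans_hom, Iso.symm_hom, Functor.mapIso_hom, Iso.op_hom,
      Scheme.Spec_map, Quiver.Hom.unop_op, Scheme.Hom.comp_appTop, CommRingCat.comp_apply]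
    rw [AffineSpace.SpecIso_inv_appTop_coord, ← CommRingCat.comp_apply,
      ← Scheme.ΓSpecIso_inv_naturality, CommRingCat.comp_apply]
    congr 1
    simp
  rw [AffineSpace.toSpecMvPolyIntEquiv_comp]
  refine h.trans ?_
  rw [AffineSpace.toSpecMvPolyIntEquiv_apply, ← CommRingCat.comp_apply,
      ← Scheme.ΓSpecIso_inv_naturality, CommRingCat.comp_apply]
  congr 1
  exact (evalInt_X _ i).symm

lemma affSpec_naturality {R S : Type u} [CommRing R] [CommRing S] (f : R →+* S) :
    Spec.map (CommRingCat.ofHom (mapRingHom f)) ≫ (affSpec R).hom =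
      (affSpec S).hom ≫ AffineSpace.map _ (Spec.map (CommRingCat.ofHom f)) := by
  apply affLine_hom_ext
  · rw [Category.assoc, affSpec_hom_pr, Category.assoc, AffineSpace.map_over, ← Category.assoc,
      affSpec_hom_pr, ← Spec.map_comp, ← Spec.map_comp, ← CommRingCat.ofHom_comp,
      ← CommRingCat.ofHom_comp, mapRingHom_comp_C]
  · rw [Category.assoc, affSpec_hom_toSpecMvPoly, Category.assoc, AffineSpace.map_toSpecMvPoly,
      affSpec_hom_toSpecMvPoly, ← Spec.map_comp, ← CommRingCat.ofHom_comp, comp_evalInt,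
      coe_mapRingHom, map_X]

end AffineLine

/-! ### The two standard charts of the projective line -/

namespace Cylinders

open HomogeneousLocalization

section AwayEval

variable {M : Type u} [CommRing M]

/-- The homomorphism `ℤ[x₀, x₁]_{(f)} → M` given by `H : ℤ[x₀, x₁] → M` with `H f` invertible. -/
def awayEval (f : ProjCoord.{u}) (H : ProjCoord.{u} →+* M) (hu : IsUnit (H f)) :
    Away projGrading.{u} f →+* M :=
  (IsLocalization.Away.lift (S := Localization.Away f) f hu).comp
    (algebraMap _ (Localization.Away f))

lemma awayEval_mk {f : ProjCoord.{u}} {d : ℕ} (hf : f ∈ projGrading.{u} d)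
    (H : ProjCoord.{u} →+* M) (hu : IsUnit (H f)) (n : ℕ) (a : ProjCoord.{u})
    (ha : a ∈ projGrading.{u} (n • d)) :
    awayEval f H hu (Away.mk projGrading.{u} hf n a ha) * H f ^ n = H a := by
  change IsLocalization.Away.lift (S := Localization.Away f) f hu
    (Localization.mk a ⟨f ^ n, ⟨n, rfl⟩⟩) * _ = H a
  rw [Localization.mk_eq_mk', ← map_pow,
    ← IsLocalization.Away.lift_eq (S := Localization.Away f) f hu (f ^ n), ← map_mul]
  have := IsLocalization.mk'_spec (Localization.Away f) a
    (⟨f ^ n, ⟨n, rfl⟩⟩ : Submonoid.powers f)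
  simp only at this
  rw [this, IsLocalization.Away.lift_eq]

lemma awayEval_comp_awayMap {f g x : ProjCoord.{u}} {m n : ℕ} (hf : f ∈ projGrading.{u} m)
    (hg : g ∈ projGrading.{u} n) (hx : x = f * g) (H : ProjCoord.{u} →+* M)
    (hu : IsUnit (H f)) (hux : IsUnit (H x)) :
    (awayEval x H hux).comp (awayMap projGrading.{u} hg hx) = awayEval f H hu := by
  ext z
  obtain ⟨i, a, ha, rfl⟩ := Away.mk_surjective projGrading.{u} hf z
  have h1 := awayEval_mk hf H hu i a ha
  rw [RingHom.comp_apply, awayMap_mk]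
  refine (hux.pow i).mul_left_injective ?_
  dsimp only
  rw [awayEval_mk]
  simp only [hx, map_mul, map_pow, mul_pow]
  rw [← mul_assoc, h1]

/-- When H inverts both f and g, both sides factor through the chart of the product f g. -/
lemma specMap_awayEval_awayι {f g : ProjCoord.{u}} {m n : ℕ} (hf : f ∈ projGrading.{u} m)
    (hg : g ∈ projGrading.{u} n) (hm : 0 < m) (hn : 0 < n) (H : ProjCoord.{u} →+* M)
    (hu : IsUnit (H f)) (hug : IsUnit (H g)) :
    Spec.map (CommRingCat.ofHom (awayEval f H hu)) ≫ Proj.awayι projGrading.{u} f hf hm =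
      Spec.map (CommRingCat.ofHom (awayEval g H hug)) ≫ Proj.awayι projGrading.{u} g hg hn := by
  have hux : IsUnit (H (f * g)) := by rw [map_mul]; exact hu.mul hug
  rw [← awayEval_comp_awayMap hf hg rfl H hu hux,
    ← awayEval_comp_awayMap hg hf (mul_comm f g) H hug hux, CommRingCat.ofHom_comp,
    CommRingCat.ofHom_comp, Spec.map_comp, Spec.map_comp, Category.assoc, Category.assoc,
    Proj.SpecMap_awayMap_awayι, Proj.SpecMap_awayMap_awayι]
  rfl

end AwayEval

/-- The dehomogenization `ℤ[x₀, x₁] ⟶ ℤ[t]`, `x₀ ↦ 1`, `x₁ ↦ t`. -/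
def dehomInf : ProjCoord.{u} →+* MvPolynomial PUnit.{u + 1} (ULift.{u} ℤ) :=
  dehom.comp (MvPolynomial.rename (Equiv.swap 0 1)).toRingHom

lemma dehomInf_X_zero : dehomInf.{u} (MvPolynomial.X 0) = 1 := by
  simp [dehomInf, dehom]

lemma dehomInf_X_one : dehomInf.{u} (MvPolynomial.X 1) = MvPolynomial.X PUnit.unit := by
  simp [dehomInf, dehom]

/-- The ring homomorphism `ℤ[x₀, x₁]_{(x₀)} ⟶ ℤ[t]` with `x₁ / x₀ ↦ t`. -/
def awayDehomInf : Away projGrading.{u} (MvPolynomial.X 0) →+*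
    MvPolynomial PUnit.{u + 1} (ULift.{u} ℤ) :=
  awayEval (MvPolynomial.X 0) dehomInf (by simp [dehomInf_X_zero])

lemma awayDehomInf_mk (n : ℕ) (a : ProjCoord.{u}) (ha : a ∈ projGrading.{u} (n • 1)) :
    awayDehomInf (Away.mk projGrading.{u} (X_mem.{u} 0) n a ha) = dehomInf a := by
  have := awayEval_mk (X_mem.{u} 0) dehomInf (by simp [dehomInf_X_zero]) n a ha
  simp only [dehomInf_X_zero, one_pow, mul_one] at this
  exact this

lemma awayDehomInf_bijective : Function.Bijective awayDehomInf.{u} := by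
  constructor
  · rw [injective_iff_map_eq_zero]
    intro x hx
    obtain ⟨n, a, ha, rfl⟩ := Away.mk_surjective projGrading.{u} (X_mem.{u} 0) x
    rw [awayDehomInf_mk] at hx
    have h1 : MvPolynomial.rename (Equiv.swap (0 : Fin 2) 1) a = 0 :=
      eq_zero_of_dehom_eq_zero (MvPolynomial.IsHomogeneous.rename_isHomogeneous ha) hx
    obtain rfl : a = 0 :=
      MvPolynomial.rename_injective _ (Equiv.swap (0 : Fin 2) 1).injective (by rw [h1, map_zero])
    apply HomogeneousLocalization.val_injective
    rw [HomogeneousLocalization.val_zero]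
    exact Localization.mk_zero _
  · intro p
    change p ∈ awayDehomInf.{u}.rangeS
    induction p using MvPolynomial.induction_on with
    | C a =>
      have h0 : (MvPolynomial.C a : ProjCoord.{u}) ∈ projGrading.{u} (0 • 1) := by
        rw [zero_smul]
        exact MvPolynomial.isHomogeneous_C _ _
      exact ⟨_, (awayDehomInf_mk 0 _ h0).trans (by simp [dehomInf, dehom])⟩
    | add p q hp hq => exact add_mem hp hq
    | mul_X p i hp =>
      refine mul_mem hp ⟨Away.mk projGrading.{u} (X_mem.{u} 0) 1 (MvPolynomial.X 1)
        (X_mem.{u} 1), ?_⟩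
      rw [awayDehomInf_mk _ _ (X_mem.{u} 1), dehomInf_X_one]

/-- The standard chart `𝔸¹ ⟶ ℙ¹` at infinity, `t ↦ [1 : t]`, over the integers. -/
def chartInfInt :
    Spec (CommRingCat.of (MvPolynomial PUnit.{u + 1} (ULift.{u} ℤ))) ⟶ ProjLineInt.{u} :=
  Spec.map (CommRingCat.ofHom awayDehomInf.{u}) ≫
    Proj.awayι projGrading.{u} (MvPolynomial.X 0) (m := 1) (X_mem.{u} 0) one_pos

/-- The projection `S × ℙ¹ ⟶ ℙ¹` to the projective line over the integers. -/
def ProjLine.snd (S : Scheme.{u}) : ProjLine S ⟶ ProjLineInt.{u} := pullback.snd _ _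

lemma ProjLine.hom_ext {S W : Scheme.{u}} {f g : W ⟶ ProjLine S}
    (h₁ : f ≫ ProjLine.pr S = g ≫ ProjLine.pr S) (h₂ : f ≫ ProjLine.snd S = g ≫ ProjLine.snd S) :
    f = g :=
  pullback.hom_ext h₁ h₂

lemma chart_snd (S : Scheme.{u}) : chart S ≫ ProjLine.snd S =
    AffineSpace.toSpecMvPoly PUnit.{u + 1} S ≫ chartInt :=
  pullback.lift_snd _ _ _

/-- The standard chart `S × 𝔸¹ ⟶ S × ℙ¹` at infinity. -/
def chartInf (S : Scheme.{u}) : AffLine S ⟶ ProjLine S :=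
  pullback.lift (AffLine.pr S) (AffineSpace.toSpecMvPoly PUnit.{u + 1} S ≫ chartInfInt) (by simp)

lemma chartInf_pr (S : Scheme.{u}) : chartInf S ≫ ProjLine.pr S = AffLine.pr S :=
  pullback.lift_fst _ _ _

lemma chartInf_snd (S : Scheme.{u}) : chartInf S ≫ ProjLine.snd S =
    AffineSpace.toSpecMvPoly PUnit.{u + 1} S ≫ chartInfInt :=
  pullback.lift_snd _ _ _

instance isIso_awayDehomInf : IsIso (CommRingCat.ofHom awayDehomInf.{u}) :=
    (ConcreteCategory.isIso_iff_bijective _).mpr awayDehomInf_bijective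

instance isIso_awayDehom : IsIso (CommRingCat.ofHom awayDehom.{u}) :=
    (ConcreteCategory.isIso_iff_bijective _).mpr awayDehom_bijective

instance isOpenImmersion_chartInfInt : IsOpenImmersion chartInfInt.{u} := by
  unfold chartInfInt
  infer_instance

lemma range_chartInt_union (x : ProjLineInt.{u}) :
    x ∈ Set.range chartInt.{u} ∨ x ∈ Set.range chartInfInt.{u} := by
  have h1 : Set.range chartInt.{u} = Proj.basicOpen projGrading.{u} (MvPolynomial.X 1) := by
    have := Scheme.Hom.opensRange_comp_of_isIso (Spec.map (CommRingCat.ofHom awayDehom.{u}))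
      (Proj.awayι projGrading.{u} (MvPolynomial.X 1) (m := 1) (X_mem.{u} 1) one_pos)
    rw [Proj.opensRange_awayι] at this
    exact congrArg (SetLike.coe) this
  have h2 : Set.range chartInfInt.{u} = Proj.basicOpen projGrading.{u} (MvPolynomial.X 0) := by
    have := Scheme.Hom.opensRange_comp_of_isIso (Spec.map (CommRingCat.ofHom awayDehomInf.{u}))
      (Proj.awayι projGrading.{u} (MvPolynomial.X 0) (m := 1) (X_mem.{u} 0) one_pos)
    rw [Proj.opensRange_awayι] at this
    exact congrArg (SetLike.coe) this
  have h3 := Proj.iSup_basicOpen_eq_top' projGrading.{u}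
    (fun i : Fin 2 => (MvPolynomial.X i : ProjCoord.{u})) (fun i => ⟨1, X_mem i⟩) (by
      rw [← top_le_iff]
      intro p _
      induction p using MvPolynomial.induction_on with
      | C a =>
        exact Subalgebra.algebraMap_mem (Algebra.adjoin (projGrading.{u} 0) _)
          ⟨MvPolynomial.C a, MvPolynomial.isHomogeneous_C _ _⟩
      | add p q hp hq => exact add_mem (hp trivial) (hq trivial)
      | mul_X p i hp => exact mul_mem (hp trivial) (Algebra.subset_adjoin ⟨i, rfl⟩))
  have h4 : x ∈ ⨆ i : Fin 2, Proj.basicOpen projGrading.{u} (MvPolynomial.X i) := by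
    rw [h3]; trivial
  obtain ⟨i, hi⟩ := TopologicalSpace.Opens.mem_iSup.mp h4
  rw [h1, h2]
  fin_cases i
  · exact Or.inr hi
  · exact Or.inl hi

lemma lift_eq_pullbackMap (S : Scheme.{u})
    (c : Spec (CommRingCat.of (MvPolynomial PUnit.{u + 1} (ULift.{u} ℤ))) ⟶ ProjLineInt.{u}) :
    (pullback.lift (AffLine.pr S) (AffineSpace.toSpecMvPoly PUnit.{u + 1} S ≫ c) (by simp) :
      AffLine S ⟶ ProjLine S) =
    pullback.map (terminal.from S) (terminal.from _) (terminal.from S)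
      (terminal.from ProjLineInt.{u}) (𝟙 S) c (𝟙 _) (by simp) (by simp) := by
  apply pullback.hom_ext <;> simp [AffineSpace.toSpecMvPoly] <;> rfl

instance isOpenImmersion_chartInf (S : Scheme.{u}) : IsOpenImmersion (chartInf S) := by
  rw [chartInf, lift_eq_pullbackMap]
  exact MorphismProperty.pullbackMap (P := @IsOpenImmersion)
    (inferInstanceAs (IsOpenImmersion (𝟙 S))) (inferInstanceAs (IsOpenImmersion chartInfInt.{u}))
    (Subsingleton.elim _ _) (Subsingleton.elim _ _)

lemma range_chart_union (S : Scheme.{u}) (x : ProjLine S) :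
    x ∈ Set.range (chart S) ∨ x ∈ Set.range (chartInf S) := by
  have h1 : ∀ (c : Spec (CommRingCat.of (MvPolynomial PUnit.{u + 1} (ULift.{u} ℤ))) ⟶
      ProjLineInt.{u}), ProjLine.snd S x ∈ Set.range c →
      x ∈ Set.range (pullback.lift (AffLine.pr S)
        (AffineSpace.toSpecMvPoly PUnit.{u + 1} S ≫ c) (by simp) : AffLine S ⟶ ProjLine S) := by
    intro c hc
    rw [lift_eq_pullbackMap]
    exact (Scheme.Pullback.range_map (terminal.from S) (terminal.from _) (terminal.from S)
      (terminal.from ProjLineInt.{u}) (𝟙 S) c (𝟙 _) (by simp) (by simp)).symm.le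
        ⟨⟨pullback.fst (terminal.from S) (terminal.from ProjLineInt.{u}) x, rfl⟩, hc⟩
  exact (range_chartInt_union _).imp (h1 _) (h1 _)

/-! ### The transition t ↦ 1/t between the two charts. -/

section Overlap

variable {M : Type u} [CommRing M]

lemma evalInt_comp_awayDehom (s : M) (h) : (evalInt s).comp awayDehom =
    awayEval (MvPolynomial.X 1) ((evalInt s).comp dehom) h := by
  ext z
  obtain ⟨i, a, ha, rfl⟩ := Away.mk_surjective projGrading.{u} (X_mem.{u} 1) z
  have h1 := awayEval_mk (X_mem 1) _ h i a ha
  rw [RingHom.comp_apply, awayDehom_mk]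
  rw [← RingHom.comp_apply (evalInt s) dehom, ← h1]
  simp [dehom]

lemma evalInt_comp_awayDehomInf {s s' : M} (hs : s * s' = 1) (h) :
    (evalInt s').comp awayDehomInf =
      awayEval (MvPolynomial.X 0) ((evalInt s).comp dehom) h := by
  -- σ, with t ↦ x₁/x₀, is inverse to `awayDehomInf`; precomposing with it reduces the identity to
  -- the image of t.
  obtain ⟨σ, hσ⟩ : ∃ σ : MvPolynomial PUnit.{u + 1} (ULift.{u} ℤ) →+*
      Away projGrading.{u} (MvPolynomial.X 0), σ = evalInt (Away.mk projGrading.{u} (X_mem.{u} 0) 1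
        (MvPolynomial.X 1) (X_mem.{u} 1)) := ⟨_, rfl⟩
  have h1 : awayDehomInf.comp σ = RingHom.id _ := by
    rw [hσ, comp_evalInt, awayDehomInf_mk _ _ (X_mem.{u} 1), dehomInf_X_one]
    apply MvPolynomial.ringHom_ext
    · intro r
      obtain ⟨n⟩ := r
      simp only [evalInt, MvPolynomial.coe_eval₂Hom, MvPolynomial.eval₂_C, RingHom.id_apply]
      exact (map_intCast (MvPolynomial.C (σ := PUnit.{u + 1}) (R := ULift.{u} ℤ)) n).symm
    · simp [evalInt]
  have h2 : Function.Surjective σ := fun z =>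
    ⟨awayDehomInf z, awayDehomInf_bijective.1 (RingHom.congr_fun h1 (awayDehomInf z))⟩
  rw [← RingHom.cancel_right h2, RingHom.comp_assoc, h1, hσ, comp_evalInt, RingHom.comp_id]
  congr 1
  refine h.mul_left_injective ?_
  have h3 := awayEval_mk (X_mem 0) _ h 1 (MvPolynomial.X 1) (X_mem.{u} 1)
  rw [pow_one] at h3
  dsimp only
  rw [h3]
  simp [dehom, evalInt, mul_comm s', hs]

lemma specMap_evalInt_chartInt {s s' : M} (hs : s * s' = 1) :
    Spec.map (CommRingCat.ofHom (evalInt s)) ≫ chartInt =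
      Spec.map (CommRingCat.ofHom (evalInt s')) ≫ chartInfInt := by
  have h0 : IsUnit ((evalInt s).comp dehom (MvPolynomial.X 0)) := by
    simpa [dehom, evalInt] using IsUnit.of_mul_eq_one _ hs
  have h1 : IsUnit ((evalInt s).comp dehom (MvPolynomial.X 1)) := by
    simp [dehom]
  rw [chartInt, chartInfInt, ← Category.assoc, ← Category.assoc, ← Spec.map_comp, ← Spec.map_comp,
    ← CommRingCat.ofHom_comp, ← CommRingCat.ofHom_comp, evalInt_comp_awayDehom s h1,
    evalInt_comp_awayDehomInf hs h0]
  exact specMap_awayEval_awayι _ _ _ _ _ _ _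

lemma comp_chart_eq_comp_chartInf {S : Scheme.{u}} {h₁ h₂ : Spec (.of M) ⟶ AffLine S}
    (h : h₁ ≫ AffLine.pr S = h₂ ≫ AffLine.pr S) {s s' : M} (hs : s * s' = 1)
    (h₁s : h₁ ≫ AffineSpace.toSpecMvPoly _ S = Spec.map (CommRingCat.ofHom (evalInt s)))
    (h₂s : h₂ ≫ AffineSpace.toSpecMvPoly _ S = Spec.map (CommRingCat.ofHom (evalInt s'))) :
    h₁ ≫ chart S = h₂ ≫ chartInf S := by
  apply ProjLine.hom_ext
  · rw [Category.assoc, Category.assoc, chart_pr, chartInf_pr, h]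
  · rw [Category.assoc, Category.assoc, chart_snd, chartInf_snd, ← Category.assoc,
      ← Category.assoc, h₁s, h₂s, specMap_evalInt_chartInt hs]

end Overlap

/-- The projective line is functorial in the base. -/
def ProjLine.map {S T : Scheme.{u}} (f : S ⟶ T) : ProjLine S ⟶ ProjLine T :=
  pullback.map _ _ _ _ f (𝟙 _) (𝟙 _) (by simp) (by simp)

lemma ProjLine.map_pr {S T : Scheme.{u}} (f : S ⟶ T) :
    ProjLine.map f ≫ ProjLine.pr T = ProjLine.pr S ≫ f :=
  pullback.lift_fst _ _ _

lemma ProjLine.map_snd {S T : Scheme.{u}} (f : S ⟶ T) :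
    ProjLine.map f ≫ ProjLine.snd T = ProjLine.snd S :=
  (pullback.lift_snd _ _ _).trans (Category.comp_id _)

lemma chart_map {S T : Scheme.{u}} (f : S ⟶ T) :
    chart S ≫ ProjLine.map f = AffineSpace.map _ f ≫ chart T := by
  apply ProjLine.hom_ext
  · rw [Category.assoc, ProjLine.map_pr, Category.assoc, chart_pr, AffineSpace.map_over,
      ← Category.assoc, chart_pr]
  · rw [Category.assoc, ProjLine.map_snd, Category.assoc, chart_snd, chart_snd,
      ← Category.assoc (AffineSpace.map _ f), AffineSpace.map_toSpecMvPoly]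

end Cylinders

/-! ### The projective line over an affine scheme -/

namespace Cylinders

open Polynomial

section AffHom

variable {R M : Type u} [CommRing R] [CommRing M]

/-- The morphism from `Spec M` to the affine line over `Spec R` given by `R[X] → M`. -/
def affHom (α : R[X] →+* M) : Spec (.of M) ⟶ AffLine (Spec (.of R)) :=
  Spec.map (CommRingCat.ofHom α) ≫ (affSpec R).hom

lemma affHom_pr (α : R[X] →+* M) :
    affHom α ≫ AffLine.pr _ = Spec.map (CommRingCat.ofHom (α.comp C)) := by
  rw [affHom, Category.assoc, affSpec_hom_pr, ← Spec.map_comp, ← CommRingCat.ofHom_comp]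

lemma affHom_toSpecMvPoly (α : R[X] →+* M) :
    affHom α ≫ AffineSpace.toSpecMvPoly _ _ = Spec.map (CommRingCat.ofHom (evalInt (α X))) := by
  rw [affHom, Category.assoc, affSpec_hom_toSpecMvPoly, ← Spec.map_comp, ← CommRingCat.ofHom_comp,
    comp_evalInt]

lemma specMap_affHom {N : Type u} [CommRing N] (f : M →+* N) (α : R[X] →+* M) :
    Spec.map (CommRingCat.ofHom f) ≫ affHom α = affHom (f.comp α) := by
  rw [affHom, affHom, ← Category.assoc, ← Spec.map_comp, ← CommRingCat.ofHom_comp]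

lemma affHom_map {S : Type u} [CommRing S] (f : S →+* R) (α : R[X] →+* M) :
    affHom α ≫ AffineSpace.map _ (Spec.map (CommRingCat.ofHom f)) =
      affHom (α.comp (mapRingHom f)) := by
  rw [affHom, affHom, Category.assoc, ← affSpec_naturality, CommRingCat.ofHom_comp, Spec.map_comp,
    Category.assoc]

lemma isDominant_affHom [IsDomain R] {α : R[X] →+* M} (hα : Function.Injective α) :
    IsDominant (affHom α) := by
  have := isDominant_specMap α hα
  unfold affHom
  infer_instance

lemma affHom_chart_eq {α β : R[X] →+* M} (h : α.comp C = β.comp C) (hX : α X * β X = 1) :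
    affHom α ≫ chart _ = affHom β ≫ chartInf _ :=
  comp_chart_eq_comp_chartInf (by rw [affHom_pr, affHom_pr, h]) hX (affHom_toSpecMvPoly α)
    (affHom_toSpecMvPoly β)

end AffHom

section Domain

variable {R : Type u} [CommRing R] [IsDomain R]

instance isIntegral_affLine : AlgebraicGeometry.IsIntegral (AffLine (Spec (.of R))) := by
  have : Nonempty (AffLine (Spec (.of R))) := ⟨(affSpec R).hom (Classical.arbitrary _)⟩
  exact isIntegral_of_isOpenImmersion (affSpec R).inv

instance isIntegral_projLine : AlgebraicGeometry.IsIntegral (ProjLine (Spec (.of R))) := by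
  let L := FractionRing R[X]
  have hX : algebraMap R[X] L X * (algebraMap R[X] L X)⁻¹ = 1 :=
    mul_inv_cancel₀ (by simp [FaithfulSMul.algebraMap_eq_zero_iff])
  refine isIntegral_of_two_cover (range_chart_union _)
    (w₁ := affHom (algebraMap R[X] L))
    (w₂ := affHom (eval₂RingHom ((algebraMap R[X] L).comp C) (algebraMap R[X] L X)⁻¹))
    (affHom_chart_eq ?_ ?_)
  · ext; simp
  · simpa using hX

end Domain

lemma exists_specMap_away_eq {R : Type u} [CommRing R] {v : R} {y : Spec (.of R)}
    (hy : v ∉ PrimeSpectrum.asIdeal y) : ∃ z : Spec (.of (Localization.Away v)),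
      Spec.map (CommRingCat.ofHom (algebraMap R (Localization.Away v))) z = y :=
  (PrimeSpectrum.localization_away_comap_range (Localization.Away v) v).symm.le hy

/-- If t = (as + b)/(cs + d) with c ≠ 0, then t is regular near s = ∞. There the second line ψ,
evaluated at t, extends φ; the two pieces agree at the generic point and therefore glue. -/
theorem exists_projLine_extension {K L : Type u} [Field K] [Field L] {X : Scheme.{u}}
    [X.IsSeparated] {φ ψ : AffLine (Spec (.of K)) ⟶ X} {α β : K[X] →+* L}
    (hα : Function.Injective α) (hC : α.comp C = β.comp C) {a b c d : K} (hc : c ≠ 0)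
    (habcd : β Polynomial.X * (α (C c) * α Polynomial.X + α (C d)) =
      α (C a) * α Polynomial.X + α (C b))
    (h : affHom α ≫ φ = affHom β ≫ ψ) :
    ∃ g : ProjLine (Spec (.of K)) ⟶ X, chart _ ≫ g = φ := by
  -- With u = 1/s as coordinate at infinity, t = (a + bu)/(c + du); v is this denominator, α' is the
  -- generic point in the coordinate u, and γ below encodes t.
  obtain ⟨v, hv⟩ : ∃ v : K[X], v = C c + C d * Polynomial.X := ⟨_, rfl⟩
  let N := Localization.Away v
  let ι := algebraMap K[X] N
  obtain ⟨w, hw⟩ : ∃ w : N, ι v * w = 1 :=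
    ⟨_, IsLocalization.Away.mul_invSelf (S := N) v⟩
  have hs : α Polynomial.X ≠ 0 := by
    rw [Ne, map_eq_zero_iff α hα]; exact X_ne_zero
  let α' : K[X] →+* L := eval₂RingHom (α.comp C) (α Polynomial.X)⁻¹
  have hα'C : ∀ x, α' (C x) = α (C x) := fun x => by simp [α']
  have hα'X : α' Polynomial.X = (α Polynomial.X)⁻¹ := by simp [α']
  have hv0 : α (C c) * α Polynomial.X + α (C d) ≠ 0 := by
    rw [← map_mul, ← map_add, Ne, map_eq_zero_iff α hα]
    intro h0
    have := congrArg (coeff · 1) h0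
    simp at this
    exact hc this
  have hv' : α' v * α Polynomial.X = α (C c) * α Polynomial.X + α (C d) := by
    rw [hv, map_add, map_mul, hα'C, hα'C, hα'X]
    field_simp
  have hvu : IsUnit (α' v) := by
    rw [isUnit_iff_ne_zero]
    intro h0
    rw [h0, zero_mul] at hv'
    exact hv0 hv'.symm
  let δ : N →+* L := IsLocalization.Away.lift v hvu
  have hδ : δ.comp ι = α' := IsLocalization.Away.lift_comp v hvu
  let γ : K[X] →+* N := eval₂RingHom (ι.comp C) (ι (C a + C b * Polynomial.X) * w)
  have hδγ : δ.comp γ = β := by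
    have hδι : ∀ x, δ (ι x) = α' x := fun x => RingHom.congr_fun hδ x
    apply Polynomial.ringHom_ext
    · intro x
      simp only [γ, RingHom.comp_apply, coe_eval₂RingHom, eval₂_C, hδι, hα'C]
      exact RingHom.congr_fun hC x
    · simp only [γ, RingHom.comp_apply, coe_eval₂RingHom, eval₂_X, map_mul δ, hδι]
      have h1 : α' v * δ w = 1 := by rw [← hδι, ← map_mul, hw, map_one]
      have h2 : α' (C a + C b * Polynomial.X) * α Polynomial.X = β Polynomial.X *
          (α' v * α Polynomial.X) := by
        rw [hv', habcd, map_add, map_mul, hα'C, hα'C, hα'X]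
        field_simp
      have h3 : α' (C a + C b * Polynomial.X) = β Polynomial.X * α' v := by
        refine mul_right_cancel₀ hs ?_
        rw [h2, mul_assoc]
      rw [h3, mul_assoc, h1, mul_one]
  have : IsOpenImmersion (Spec.map (CommRingCat.ofHom ι)) :=
    inferInstanceAs (IsOpenImmersion (Spec.map (CommRingCat.ofHom (algebraMap K[X] N))))
  have : IsOpenImmersion (affHom ι) := by
    unfold affHom
    infer_instance
  have hcov : ∀ x, x ∈ Set.range (chart (Spec (.of K))) ∨
      x ∈ Set.range (affHom ι ≫ chartInf (Spec (.of K))) := by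
    intro x
    refine (range_chart_union _ x).elim Or.inl ?_
    rintro ⟨y, rfl⟩
    obtain ⟨y, rfl⟩ := (affSpec K).hom.surjective y
    -- Where v = c + du vanishes, u cannot vanish because c ≠ 0, so the point already lies in the
    -- finite chart.
    by_cases hy : v ∈ PrimeSpectrum.asIdeal y
    · left
      have hyX : Polynomial.X ∉ PrimeSpectrum.asIdeal y := by
        intro hX
        have h1 : C c ∈ PrimeSpectrum.asIdeal y := by
          rw [show C c = v - C d * Polynomial.X by rw [hv]; ring]
          exact Ideal.sub_mem _ hy (Ideal.mul_mem_left _ _ hX)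
        exact y.2.ne_top (Ideal.eq_top_of_isUnit_mem _ h1
          (isUnit_C.mpr (isUnit_iff_ne_zero.mpr hc)))
      obtain ⟨z, hz⟩ := exists_specMap_away_eq hyX
      let N' := Localization.Away (Polynomial.X : K[X])
      let ι' := algebraMap K[X] N'
      obtain ⟨w', hw'⟩ : ∃ w' : N', ι' Polynomial.X * w' = 1 :=
        ⟨_, IsLocalization.Away.mul_invSelf (S := N') Polynomial.X⟩
      have h1 : affHom (eval₂RingHom (ι'.comp C) w') ≫ chart _ = affHom ι' ≫ chartInf _ := by
        apply affHom_chart_eq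
        · ext; simp
        · simpa [mul_comm] using hw'
      refine ⟨affHom (eval₂RingHom (ι'.comp C) w') z, ?_⟩
      rw [← Scheme.Hom.comp_apply, h1, Scheme.Hom.comp_apply, ← hz]
      rfl
    · right
      obtain ⟨z, hz⟩ := exists_specMap_away_eq hy
      refine ⟨z, ?_⟩
      rw [Scheme.Hom.comp_apply, ← hz]
      rfl
  have hw12 : affHom α ≫ chart _ =
      Spec.map (CommRingCat.ofHom δ) ≫ affHom ι ≫ chartInf (Spec (.of K)) := by
    rw [← Category.assoc, specMap_affHom, hδ]
    apply affHom_chart_eq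
    · ext; simp [α']
    · rw [hα'X, mul_inv_cancel₀ hs]
  have := isDominant_affHom hα
  have := isDominant_of_isOpenImmersion (chart (Spec (.of K)))
  obtain ⟨g, hg, -⟩ := exists_glue_of_separated (f₁ := φ) (f₂ := affHom γ ≫ ψ) hcov hw12
    (by rw [h, ← Category.assoc, specMap_affHom, hδγ])
  exact ⟨g, hg⟩

end Cylinders

/-! ### Affine charts and dimension -/

section Charts

variable {k : Type u} [Field k] {Z : Scheme.{u}} (q : Z ⟶ Spec (.of k))

lemma finiteType_of_isOpenImmersion [LocallyOfFiniteType q] {A : Type u} [CommRing A] [Algebra k A]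
    (ι : Spec (.of A) ⟶ Z) [IsOpenImmersion ι]
    (hι : ι ≫ q = Spec.map (CommRingCat.ofHom (algebraMap k A))) : Algebra.FiniteType k A := by
  have : LocallyOfFiniteType (Spec.map (CommRingCat.ofHom (algebraMap k A))) := by
    rw [← hι]; infer_instance
  rw [HasRingHomProperty.Spec_iff (P := @LocallyOfFiniteType)] at this
  exact RingHom.finiteType_algebraMap.mp this

lemma exists_algebra_of_affine {A : Type u} [CommRing A] (ι : Spec (.of A) ⟶ Z) :
    ∃ _ : Algebra k A, ι ≫ q = Spec.map (CommRingCat.ofHom (algebraMap k A)) :=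
  ⟨(Spec.preimage (ι ≫ q)).hom.toAlgebra, (Spec.map_preimage _).symm⟩

lemma exists_affine_chart (z : Z) :
    ∃ (A : Type u) (_ : CommRing A) (_ : Algebra k A) (ι : Spec (.of A) ⟶ Z),
      IsOpenImmersion ι ∧ z ∈ Set.range ι ∧
      ι ≫ q = Spec.map (CommRingCat.ofHom (algebraMap k A)) := by
  obtain ⟨y, hy⟩ := Z.affineCover.covers z
  obtain ⟨hA, h⟩ := exists_algebra_of_affine q (A := (Z.affineOpenCover.X (Z.affineCover.idx z)))
    (Z.affineCover.f (Z.affineCover.idx z))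
  exact ⟨_, _, hA, _, inferInstanceAs (IsOpenImmersion (Z.affineCover.f (Z.affineCover.idx z))),
    ⟨y, hy⟩, h⟩

lemma isDomain_of_isOpenImmersion [AlgebraicGeometry.IsIntegral Z] {A : Type u} [CommRing A]
    [Nontrivial A] (ι : Spec (.of A) ⟶ Z) [IsOpenImmersion ι] : IsDomain A := by
  have : AlgebraicGeometry.IsIntegral (Spec (.of A)) := isIntegral_of_isOpenImmersion ι
  exact (affine_isIntegral_iff (.of A)).mp this

/-- Both dimensions are the transcendence degree over k of the common function field. -/
lemma ringKrullDim_eq_of_isOpenImmersion [AlgebraicGeometry.IsIntegral Z] [LocallyOfFiniteType q]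
    {A B : Type u} [CommRing A] [CommRing B] [Algebra k A] [Algebra k B] [IsDomain A] [IsDomain B]
    (ι : Spec (.of A) ⟶ Z) (κ : Spec (.of B) ⟶ Z) [IsOpenImmersion ι] [IsOpenImmersion κ]
    (hι : ι ≫ q = Spec.map (CommRingCat.ofHom (algebraMap k A)))
    (hκ : κ ≫ q = Spec.map (CommRingCat.ofHom (algebraMap k B))) :
    ringKrullDim A = ringKrullDim B := by
  obtain ⟨φ, hφ, hφι⟩ := exists_isFractionMap ι
  obtain ⟨ψ, hψ, hψκ⟩ := exists_isFractionMap κ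
  have := finiteType_of_isOpenImmersion q ι hι
  have := finiteType_of_isOpenImmersion q κ hκ
  have h : φ.comp (algebraMap k A) = ψ.comp (algebraMap k B) := by
    have h1 := congrArg (· ≫ q) (hφι.trans hψκ.symm)
    simp only [Category.assoc, hι, hκ, ← Spec.map_comp, ← CommRingCat.ofHom_comp] at h1
    exact congrArg CommRingCat.Hom.hom (Spec.map_injective h1)
  let : Algebra A Z.functionField := φ.toAlgebra
  let : Algebra B Z.functionField := ψ.toAlgebra
  let : Algebra k Z.functionField := (φ.comp (algebraMap k A)).toAlgebra
  have : IsScalarTower k A Z.functionField := .of_algebraMap_eq fun _ => rfl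
  have : IsScalarTower k B Z.functionField := .of_algebraMap_eq fun x => RingHom.congr_fun h x
  have : IsFractionRing A Z.functionField := IsFractionMap.isFractionRing hφ
  have : IsFractionRing B Z.functionField := IsFractionMap.isFractionRing hψ
  obtain ⟨n, hn, hn'⟩ := exists_ringKrullDim_eq_trdeg k A
  obtain ⟨m, hm, hm'⟩ := exists_ringKrullDim_eq_trdeg k B
  rw [← trdeg_fractionRing k A Z.functionField, trdeg_fractionRing k B Z.functionField, hm',
    Nat.cast_inj] at hn'
  rw [hn, hm, hn']

/-- Dimension is the supremum of the coheights of irreducible closed sets. Each coheight can be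
computed in any affine chart meeting the set, and all nonempty charts have the same dimension. -/
theorem topologicalKrullDim_eq_ringKrullDim [AlgebraicGeometry.IsIntegral Z]
    [LocallyOfFiniteType q] {A : Type u} [CommRing A] [Algebra k A] [IsDomain A]
    (ι : Spec (.of A) ⟶ Z) [IsOpenImmersion ι]
    (hι : ι ≫ q = Spec.map (CommRingCat.ofHom (algebraMap k A))) :
    topologicalKrullDim Z = ringKrullDim A := by
  refine le_antisymm ?_ ?_
  · have : Nonempty (TopologicalSpace.IrreducibleCloseds Z) :=
      ⟨⟨Set.univ, IrreducibleSpace.isIrreducible_univ _, isClosed_univ⟩⟩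
    rw [topologicalKrullDim, Order.krullDim_eq_iSup_coheight_of_nonempty,
      WithBot.coe_iSup (by bddDefault)]
    refine iSup_le fun T => ?_
    obtain ⟨z, hz⟩ := T.isIrreducible.nonempty
    obtain ⟨B, _, _, κ, _, ⟨y, rfl⟩, hκ⟩ := exists_affine_chart q z
    have : Nontrivial B := PrimeSpectrum.nontrivial y
    have := isDomain_of_isOpenImmersion κ
    rw [ringKrullDim_eq_of_isOpenImmersion q ι κ hι hκ,
      ← PrimeSpectrum.topologicalKrullDim_eq_ringKrullDim]
    have h1 := (TopologicalSpace.IrreducibleCloseds.orderIsoOfIsOpenEmbedding κ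
      κ.isOpenEmbedding).apply_symm_apply ⟨T, ⟨y, hz⟩⟩
    have h2 := κ.isOpenEmbedding.coheight_map
      ((TopologicalSpace.IrreducibleCloseds.orderIsoOfIsOpenEmbedding κ
        κ.isOpenEmbedding).symm ⟨T, ⟨y, hz⟩⟩)
    rw [show TopologicalSpace.IrreducibleCloseds.map κ κ.isOpenEmbedding.continuous _ = T from
      congrArg Subtype.val h1] at h2
    rw [h2]
    exact Order.coheight_le_krullDim _
  · rw [← PrimeSpectrum.topologicalKrullDim_eq_ringKrullDim]
    exact ι.isOpenEmbedding.isInducing.topologicalKrullDim_le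

end Charts

/-! ### From an embedding of function fields to uniruledness. -/

namespace Cylinders

open Polynomial

lemma isVariety_specMap {k Q : Type u} [Field k] [CommRing Q] [IsReduced Q] [Algebra k Q]
    [Algebra.FiniteType k Q] : IsVariety (Spec.map (CommRingCat.ofHom (algebraMap k Q))) where
  reduced := inferInstanceAs (IsReduced (Spec (.of Q)))
  separated := inferInstance
  locallyOfFiniteType := by
    rw [HasRingHomProperty.Spec_iff (P := @LocallyOfFiniteType)]
    exact RingHom.finiteType_algebraMap.mpr ‹_›
  quasiCompact := inferInstance

/-- Frac Q[X] embeds in the function field of Spec Q × ℙ¹, so β gives a morphism from the generic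
point of that scheme to Z. It spreads out to a rational map because Z is locally of finite type, and
the rational map is dominant because its restriction to the generic point is. -/
theorem isUniruled_of_injective {k : Type u} [Field k] {Z : Scheme.{u}} (q : Z ⟶ Spec (.of k))
    [AlgebraicGeometry.IsIntegral Z] [LocallyOfFiniteType q] {A : Type u} [CommRing A]
    [Algebra k A] [IsDomain A] (ι : Spec (.of A) ⟶ Z) [IsOpenImmersion ι]
    (hι : ι ≫ q = Spec.map (CommRingCat.ofHom (algebraMap k A))) {Q : Type u} [CommRing Q]
    [Algebra k Q] [IsDomain Q] [Algebra.FiniteType k Q]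
    (hdim : ringKrullDim Q + 1 = ringKrullDim A) (β : A →ₐ[k] FractionRing Q[X])
    (hβ : Function.Injective β) : IsUniruled q := by
  let b : Spec (.of Q) ⟶ Spec (.of k) := Spec.map (CommRingCat.ofHom (algebraMap k Q))
  have hb : LocallyOfFiniteType b := isVariety_specMap.locallyOfFiniteType
  refine ⟨Spec (.of Q), b, inferInstance, isVariety_specMap, ?_, ?_⟩
  · rw [topologicalKrullDim_eq_ringKrullDim q ι hι, ← hdim]
    congr 1
    exact PrimeSpectrum.topologicalKrullDim_eq_ringKrullDim Q
  obtain ⟨θ, hθ, hθP⟩ := exists_isFractionMap ((affSpec Q).hom ≫ chart (Spec (.of Q)))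
  let K : Type u := (ProjLine (Spec (.of Q))).functionField
  let e : FractionRing Q[X] →+* K := IsFractionRing.lift hθ.injective
  have he : e.comp (algebraMap Q[X] _) = θ := by
    refine RingHom.ext fun x => ?_
    exact IsFractionRing.lift_algebraMap hθ.injective x
  let f : Spec (.of K) ⟶ Z := Spec.map (CommRingCat.ofHom (e.comp (β : A →+* _))) ≫ ι
  have hf : f ≫ q = (ProjLine (Spec (.of Q))).fromSpecStalk (genericPoint _) ≫
      ProjLine.pr (Spec (.of Q)) ≫ b := by
    rw [← hθP, Category.assoc, hι, ← Spec.map_comp, ← CommRingCat.ofHom_comp, Category.assoc,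
      Category.assoc, ← Category.assoc (chart _), chart_pr, ← Category.assoc (affSpec Q).hom,
      affSpec_hom_pr, ← Spec.map_comp, ← Spec.map_comp, ← CommRingCat.ofHom_comp,
      ← CommRingCat.ofHom_comp, RingHom.comp_assoc, AlgHom.comp_algebraMap, ← he]
  let r := Scheme.RationalMap.equivFunctionField (ProjLine.pr (Spec (.of Q)) ≫ b) q ⟨f, hf⟩
  refine ⟨r.1, ?_, r.2⟩
  change (Scheme.PartialMap.ofFromSpecStalk (ProjLine.pr (Spec (.of Q)) ≫ b) q
    f hf).toRationalMap.IsDominant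
  rw [Scheme.PartialMap.isDominant_toRationalMap_iff]
  have h1 := Scheme.PartialMap.fromSpecStalkOfMem_ofFromSpecStalk
    (ProjLine.pr (Spec (.of Q)) ≫ b) q f hf
  have h2 : IsDominant f := by
    have := isDominant_specMap (e.comp (β : A →+* _)) (e.injective.comp hβ)
    have := isDominant_of_isOpenImmersion ι
    infer_instance
  rw [← h1, Scheme.PartialMap.fromSpecStalkOfMem] at h2
  exact IsDominant.of_comp _ _ (H := h2)

end Cylinders

/-! ### Cylinders in integral varieties -/

namespace Cylinders

open Polynomial

/-- The zero section of the affine line. -/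
def zeroSection (S : Scheme.{u}) : S ⟶ AffLine S := AffineSpace.homOfVector (𝟙 S) 0

lemma zeroSection_pr (S : Scheme.{u}) : zeroSection S ≫ AffLine.pr S = 𝟙 S :=
  AffineSpace.homOfVector_over _ _

instance isOpenImmersion_affineSpace_map {S T : Scheme.{u}} (f : S ⟶ T) [IsOpenImmersion f] :
    IsOpenImmersion (AffineSpace.map PUnit.{u + 1} f) :=
  MorphismProperty.of_isPullback (P := @IsOpenImmersion)
    (AffineSpace.isPullback_map (n := PUnit.{u + 1}) f).flip ‹_›

namespace Cylinder

section Base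

variable {X S : Scheme.{u}} {p : X ⟶ S} (C : Cylinder p)

instance : IsOpenImmersion C.φ := C.isOpenImmersion

instance : Nonempty C.Z := C.nonempty

/-- The structure morphism of the base is recovered as the zero section followed by the embedding
into X. -/
instance locallyOfFiniteType_toBase [LocallyOfFiniteType p] : LocallyOfFiniteType C.toBase := by
  have h1 : zeroSection C.Z ≫ C.φ ≫ p = C.toBase := by
    rw [C.comm, ← Category.assoc, zeroSection_pr, Category.id_comp]
  have : LocallyOfFiniteType (zeroSection C.Z ≫ AffLine.pr C.Z) := by
    rw [zeroSection_pr]; infer_instance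
  have := locallyOfFiniteType_of_comp (zeroSection C.Z) (AffLine.pr C.Z)
  rw [← h1]
  infer_instance

/-- The base is the image of the irreducible Z × 𝔸¹, and it is reduced because locally A embeds in
the reduced ring A[X]. -/
instance isIntegral_Z [AlgebraicGeometry.IsIntegral X] : AlgebraicGeometry.IsIntegral C.Z := by
  have : Nonempty (AffLine C.Z) := ⟨zeroSection C.Z C.nonempty.some⟩
  have := isIntegral_of_isOpenImmersion C.φ
  have hsurj : Function.Surjective (AffLine.pr C.Z) := fun z =>
    ⟨zeroSection C.Z z, by rw [← Scheme.Hom.comp_apply, zeroSection_pr]; rfl⟩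
  have : IrreducibleSpace C.Z := by
    have h1 : IsIrreducible (Set.range (AffLine.pr C.Z)) := by
      rw [← Set.image_univ]
      exact (IrreducibleSpace.isIrreducible_univ _).image _
        (AffLine.pr C.Z).continuous.continuousOn
    rw [hsurj.range_eq] at h1
    have : PreirreducibleSpace C.Z := ⟨h1.2⟩
    exact ⟨C.nonempty⟩
  have hred : ∀ i, IsReduced (C.Z.affineCover.X i) := by
    intro i
    let A := C.Z.affineOpenCover.X i
    let ι : Spec (.of A) ⟶ C.Z := C.Z.affineCover.f i
    have : IsOpenImmersion ι := inferInstanceAs (IsOpenImmersion (C.Z.affineCover.f i))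
    have : IsReduced (AffLine (Spec (.of A))) :=
      isReduced_of_isOpenImmersion (AffineSpace.map PUnit.{u + 1} ι)
    have : IsReduced (Spec (.of A[X])) := isReduced_of_isOpenImmersion (affSpec A).hom
    have : _root_.IsReduced A[X] := (affine_isReduced_iff (.of A[X])).mp this
    have : _root_.IsReduced A :=
      isReduced_of_injective (Polynomial.C : A →+* A[X]) Polynomial.C_injective
    exact (affine_isReduced_iff A).mpr this
  have := IsReduced.of_openCover _ C.Z.affineCover
  exact isIntegral_of_irreducibleSpace_of_isReduced C.Z

end Base

variable {k : Type u} [Field k] {X : Scheme.{u}} {p : X ⟶ Spec (.of k)}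
  [AlgebraicGeometry.IsIntegral X] [LocallyOfFiniteType p] [Algebra k X.functionField]

/-- An affine open subscheme of the base of a cylinder, with the resulting presentation of the
function field of `X`. -/
theorem exists_chart (hη : X.fromSpecStalk (genericPoint X) ≫ p =
      Spec.map (CommRingCat.ofHom (algebraMap k X.functionField))) (C : Cylinder p) :
    ∃ (A : Type u) (_ : CommRing A) (_ : IsDomain A) (_ : Algebra k A)
      (_ : Algebra.FiniteType k A) (ι : Spec (.of A) ⟶ C.Z) (φ : A[X] →ₐ[k] X.functionField),
      IsOpenImmersion ι ∧ ι ≫ C.toBase = Spec.map (CommRingCat.ofHom (algebraMap k A)) ∧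
      IsFractionMap (φ : A[X] →+* X.functionField) ∧
      affHom (φ : A[X] →+* X.functionField) ≫ AffineSpace.map _ ι ≫ C.φ =
        X.fromSpecStalk (genericPoint X) := by
  obtain ⟨A, _, _, ι, _, ⟨y, -⟩, hι⟩ := exists_affine_chart C.toBase C.nonempty.some
  have : Nontrivial A := PrimeSpectrum.nontrivial y
  have := isDomain_of_isOpenImmersion ι
  obtain ⟨φ, hφ, hφη⟩ := exists_isFractionMap
    ((affSpec A).hom ≫ AffineSpace.map PUnit.{u + 1} ι ≫ C.φ)
  have hφk : ∀ x, φ (algebraMap k A[X] x) = algebraMap k X.functionField x := by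
    have h1 := congrArg (· ≫ p) hφη
    simp only [Category.assoc] at h1
    rw [hη, C.comm, ← Category.assoc (AffineSpace.map _ _), AffineSpace.map_over, Category.assoc,
      hι, ← Category.assoc (affSpec A).hom, affSpec_hom_pr, ← Spec.map_comp, ← Spec.map_comp,
      ← CommRingCat.ofHom_comp, ← CommRingCat.ofHom_comp] at h1
    exact RingHom.congr_fun (congrArg CommRingCat.Hom.hom (Spec.map_injective h1))
  refine ⟨A, _, this, _, finiteType_of_isOpenImmersion C.toBase ι hι, ι, { φ with commutes' := hφk },
    ‹_›, hι, hφ, ?_⟩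
  rw [← hφη, affHom, Category.assoc]
  rfl

end Cylinder

end Cylinders

/-! ### Comparing two cylinders with the same function field of the base -/

lemma RingHom.IsStandardOpenImmersion.isOpenImmersion_specMap {A B : Type u} [CommRing A]
    [CommRing B] {f : A →+* B} (hf : f.IsStandardOpenImmersion) :
    IsOpenImmersion (Spec.map (CommRingCat.ofHom f)) := by
  algebraize [f]
  obtain ⟨a, ha⟩ := Algebra.IsStandardOpenImmersion.exists_away A B
  exact IsOpenImmersion.of_isLocalization (S := B) a

namespace Cylinders.Cylinder

open Polynomial

section Equivalent

variable {k : Type u} [Field k] {X : Scheme.{u}} {p : X ⟶ Spec (.of k)}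
  [X.IsSeparated]

/-- Two cylinders with the same affine base whose coordinates differ by an affine transformation
are equivalent. -/
theorem equivalent_of_affine {B L : Type u} [CommRing B] [IsDomain B] [Field L] [Algebra k B]
    {C D : Cylinder p} (i : Spec (.of B) ⟶ C.Z) (i' : Spec (.of B) ⟶ D.Z) [IsOpenImmersion i]
    [IsOpenImmersion i'] (hi : i ≫ C.toBase = Spec.map (CommRingCat.ofHom (algebraMap k B)))
    (hi' : i' ≫ D.toBase = Spec.map (CommRingCat.ofHom (algebraMap k B)))
    (δ δ' : B[X] →+* L) (hδ : δ.comp Polynomial.C = δ'.comp Polynomial.C) {a b : B} (ha : IsUnit a)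
    (hab : δ' Polynomial.X = δ (Polynomial.C a * Polynomial.X + Polynomial.C b))
    (h : affHom δ ≫ AffineSpace.map _ i ≫ C.φ = affHom δ' ≫ AffineSpace.map _ i' ≫ D.φ)
    (hdom : IsDominant (affHom δ')) : D.Equivalent C := by
  -- The common sub-cylinder is the restriction of D to Spec B. It embeds in C after the coordinate
  -- change γ, X ↦ a⁻¹(X - b), chosen so that δ' ∘ γ = δ.
  let E : Cylinder p :=
    { Z := Spec (.of B)
      toBase := Spec.map (CommRingCat.ofHom (algebraMap k B))
      φ := AffineSpace.map _ i' ≫ D.φ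
      nonempty := inferInstance
      isOpenImmersion := inferInstance
      comm := by
        rw [Category.assoc, D.comm, ← Category.assoc, AffineSpace.map_over, Category.assoc, hi'] }
  obtain ⟨a, rfl⟩ := ha
  let γ : B[X] →+* B[X] := eval₂RingHom Polynomial.C
    (Polynomial.C (↑a⁻¹ : B) * (Polynomial.X - Polynomial.C b))
  let γ' : B[X] →+* B[X] := eval₂RingHom Polynomial.C
    (Polynomial.C (↑a : B) * Polynomial.X + Polynomial.C b)
  have haa : Polynomial.C (↑a : B) * Polynomial.C (↑a⁻¹ : B) = 1 := by
    rw [← Polynomial.C_mul, Units.mul_inv, Polynomial.C_1]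
  have h1 : γ.comp γ' = RingHom.id _ := by
    apply Polynomial.ringHom_ext
    · simp [γ, γ']
    · simp only [RingHom.comp_apply, γ', γ, coe_eval₂RingHom, eval₂_X, eval₂_add, eval₂_mul, eval₂_C,
        RingHom.id_apply]
      rw [← mul_assoc, haa]
      ring
  have h2 : γ'.comp γ = RingHom.id _ := by
    apply Polynomial.ringHom_ext
    · simp [γ, γ']
    · simp only [RingHom.comp_apply, γ', γ, coe_eval₂RingHom, eval₂_X, eval₂_sub, eval₂_mul, eval₂_C,
        RingHom.id_apply]
      rw [add_sub_cancel_right, ← mul_assoc, mul_comm (Polynomial.C _), haa, one_mul]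
  have hγ : IsOpenImmersion (Spec.map (CommRingCat.ofHom γ)) := by
    have : IsIso (Spec.map (CommRingCat.ofHom γ)) :=
      isIso_SpecMap_iff.mpr (RingEquiv.ofRingHom γ γ' h1 h2).bijective
    infer_instance
  have hγC : γ.comp Polynomial.C = Polynomial.C := by ext; simp [γ]
  have hδγ : δ'.comp γ = δ := by
    apply Polynomial.ringHom_ext
    · intro x
      simpa [γ] using (RingHom.congr_fun hδ x).symm
    · have hx : ∀ x, δ' (Polynomial.C x) = δ (Polynomial.C x) :=
        fun x => (RingHom.congr_fun hδ x).symm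
      simp only [RingHom.comp_apply, γ, coe_eval₂RingHom, eval₂_X, map_mul, map_sub, hx, hab]
      rw [← map_sub, ← map_mul, add_sub_cancel_right, ← mul_assoc, mul_comm (Polynomial.C _), haa,
        one_mul]
  let j₀ : AffLine (Spec (.of B)) ⟶ AffLine (Spec (.of B)) := (affSpec B).inv ≫ affHom γ
  have hj₀ : IsOpenImmersion j₀ := by
    simp only [j₀, affHom]
    infer_instance
  have hj₀pr : j₀ ≫ AffLine.pr _ = AffLine.pr _ := by
    simp only [j₀]
    rw [Category.assoc, affHom_pr, hγC, Iso.inv_comp_eq, affSpec_hom_pr]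
  have hδj₀ : affHom δ' ≫ j₀ = affHom δ := by
    simp only [j₀]
    rw [affHom, Category.assoc, Iso.hom_inv_id_assoc, specMap_affHom, hδγ]
  refine ⟨E, ⟨i', AffineSpace.map _ i', ‹_›, inferInstance, hi', ?_, rfl⟩,
    ⟨i, j₀ ≫ AffineSpace.map _ i, ‹_›, inferInstance, hi, ?_, ?_⟩⟩
  · exact AffineSpace.map_over _
  · rw [Category.assoc, AffLine.pr, AffineSpace.map_over, ← Category.assoc]
    exact congrArg (· ≫ i) hj₀pr
  · refine ext_of_isDominant (affHom δ') ?_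
    change _ = affHom δ' ≫ AffineSpace.map _ i' ≫ D.φ
    rw [← h, Category.assoc, ← Category.assoc (affHom δ'), hδj₀]

end Equivalent

/-! ### Testing vertical maximality over the fraction field of an affine chart. -/

section VerticallyMaximal

lemma mem_genericPoints_genericPoint (Z : Scheme.{u}) [IrreducibleSpace Z] :
    genericPoint Z ∈ genericPoints Z := by
  change closure {genericPoint Z} ∈ irreducibleComponents Z
  rw [genericPoint_closure Z, irreducibleComponents_eq_singleton]
  rfl

lemma exists_specMap_comp_eq_fromSpecResidueField {A : Type u} [CommRing A] [IsDomain A]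
    {Z : Scheme.{u}} [AlgebraicGeometry.IsIntegral Z] (ι : Spec (.of A) ⟶ Z) [IsOpenImmersion ι] :
    ∃ w : A →+* Z.residueField (genericPoint Z), Function.Injective w ∧
      Spec.map (CommRingCat.ofHom w) ≫ ι = Z.fromSpecResidueField (genericPoint Z) := by
  have hdom : IsDominant (Z.fromSpecResidueField (genericPoint Z)) := by
    refine ⟨?_⟩
    rw [DenseRange, Scheme.range_fromSpecResidueField, dense_iff_closure_eq]
    exact genericPoint_closure Z
  have hrange : Set.range (Z.fromSpecResidueField (genericPoint Z)) ⊆ Set.range ι := by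
    rw [Scheme.range_fromSpecResidueField, Set.singleton_subset_iff]
    exact ((genericPoint_spec Z).mem_open_set_iff ι.opensRange.isOpen).mpr
      ⟨ι (Classical.arbitrary _), trivial, ⟨_, rfl⟩⟩
  obtain ⟨v, hv⟩ : ∃ v, v ≫ ι = Z.fromSpecResidueField (genericPoint Z) :=
    ⟨IsOpenImmersion.lift ι _ hrange, IsOpenImmersion.lift_fac _ _ _⟩
  obtain ⟨w, rfl⟩ : ∃ w : CommRingCat.of A ⟶ Z.residueField (genericPoint Z), Spec.map w = v :=
    ⟨_, Spec.map_preimage _⟩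
  refine ⟨w.hom, ?_, hv⟩
  have h1 : IsDominant (Spec.map w) := by
    rw [← hv] at hdom
    exact IsDominant.of_comp_of_isOpenImmersion _ ι
  have h2 := (PrimeSpectrum.denseRange_comap_iff_ker_le_nilRadical w.hom).mp h1.denseRange
  rw [nilradical_eq_zero] at h2
  exact (RingHom.injective_iff_ker_eq_bot _).mpr (le_bot_iff.mp h2)

/-- Being a field is a proposition here, so that K keeps its given ring structure when it is a
residue field. -/
lemma exists_ringHom_of_isField {A F K : Type*} [CommRing A] [IsDomain A] [Field F] [Algebra A F]
    [IsFractionRing A F] [CommRing K] (hK : IsField K) {w : A →+* K} (hw : Function.Injective w) :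
    ∃ τ : F →+* K, τ.comp (algebraMap A F) = w := by
  have hunit : ∀ y : nonZeroDivisors A, IsUnit (w y) := fun y => by
    obtain ⟨z, hz⟩ := hK.mul_inv_cancel
      ((map_ne_zero_iff w hw).mpr (nonZeroDivisors.ne_zero y.2))
    exact IsUnit.of_mul_eq_one _ hz
  exact ⟨IsLocalization.lift hunit, IsLocalization.lift_comp hunit⟩

variable {k : Type u} [Field k] {X : Scheme.{u}} {p : X ⟶ Spec (.of k)}
  [AlgebraicGeometry.IsIntegral X]

/-- A cylinder that extends to the projective line over the function field of its base is not
vertically maximal. -/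
theorem not_isVerticallyMaximal {A F : Type u} [CommRing A] [IsDomain A] [Field F] [Algebra A F]
    [IsFractionRing A F] {C : Cylinder p} (ι : Spec (.of A) ⟶ C.Z) [IsOpenImmersion ι]
    (g : ProjLine (Spec (.of F)) ⟶ X)
    (hg : chart _ ≫ g =
      AffineSpace.map _ (Spec.map (CommRingCat.ofHom (algebraMap A F)) ≫ ι) ≫ C.φ) :
    ¬ C.IsVerticallyMaximal := by
  intro hmax
  obtain ⟨σ, hσ⟩ : ∃ σ, σ = Spec.map (CommRingCat.ofHom (algebraMap A F)) ≫ ι := ⟨_, rfl⟩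
  rw [← hσ] at hg
  -- Compatibility with the structure morphisms is automatic, since the affine chart is dense in the
  -- projective line.
  have hgp : g ≫ p = ProjLine.pr _ ≫ σ ≫ C.toBase := by
    have := isDominant_of_isOpenImmersion (chart (Spec (.of F)))
    refine ext_of_isDominant (chart _) ?_
    rw [← Category.assoc, hg, Category.assoc, C.comm, ← Category.assoc, AffineSpace.map_over,
      ← Category.assoc (chart _), chart_pr, Category.assoc]
  obtain ⟨w, hwinj, hw⟩ := exists_specMap_comp_eq_fromSpecResidueField ι
  obtain ⟨τ, hτ⟩ := exists_ringHom_of_isField (F := F)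
    (Field.toIsField (C.Z.residueField (genericPoint C.Z))) hwinj
  -- Only a map from F to the residue field is needed: the extension over F is pulled back along it.
  obtain ⟨T, hT⟩ : ∃ T : Spec (C.Z.residueField (genericPoint C.Z)) ⟶ Spec (.of F),
      T ≫ σ = C.Z.fromSpecResidueField (genericPoint C.Z) := by
    refine ⟨Spec.map (CommRingCat.ofHom τ), ?_⟩
    rw [← hw, hσ, ← hτ, CommRingCat.ofHom_comp, Spec.map_comp, Category.assoc]
    rfl
  refine hmax _ (mem_genericPoints_genericPoint C.Z) ⟨ProjLine.map T ≫ g, ?_, ?_⟩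
  · rw [← Category.assoc, chart_map, Category.assoc, hg, ← Category.assoc,
      ← AffineSpace.map_comp, hT]
    rfl
  · rw [Category.assoc, hgp, ← Category.assoc, ProjLine.map_pr, Category.assoc, ← hT,
      Category.assoc]

end VerticallyMaximal

end Cylinders.Cylinder

/-! ### Cylinders over the same field: a pole contradicts maximality, an affine change gives
equivalence. -/

namespace Cylinders.Cylinder

open Polynomial

variable {k : Type u} [Field k] {X : Scheme.{u}} {p : X ⟶ Spec (.of k)}
  [AlgebraicGeometry.IsIntegral X] [X.IsSeparated]

/-- Two cylinders whose bases have the same function field are equivalent if the first one is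
vertically maximal. -/
theorem equivalent_of_fractionsIn_eq {A R L : Type u} [CommRing A] [IsDomain A] [Algebra k A]
    [Algebra.FiniteType k A] [CommRing R] [IsDomain R] [Algebra k R] [Algebra.FiniteType k R]
    [Field L] [Algebra k L] {C D : Cylinder p} (ι : Spec (.of A) ⟶ C.Z) (κ : Spec (.of R) ⟶ D.Z)
    [IsOpenImmersion ι] [IsOpenImmersion κ]
    (hι : ι ≫ C.toBase = Spec.map (CommRingCat.ofHom (algebraMap k A)))
    (hκ : κ ≫ D.toBase = Spec.map (CommRingCat.ofHom (algebraMap k R)))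
    {φ : A[X] →ₐ[k] L} {ψ : R[X] →ₐ[k] L} (hφ : IsFractionMap (φ : A[X] →+* L))
    (hψ : IsFractionMap (ψ : R[X] →+* L))
    (h : affHom (φ : A[X] →+* L) ≫ AffineSpace.map _ ι ≫ C.φ =
      affHom (ψ : R[X] →+* L) ≫ AffineSpace.map _ κ ≫ D.φ)
    (heq : fractionsIn (constHom φ) = fractionsIn (constHom ψ)) (hmax : C.IsVerticallyMaximal) :
    D.Equivalent C := by
  let F := fractionsIn (constHom φ)
  have hαR : ∀ r, constHom ψ r ∈ F := fun r => by
    simp only [F]; rw [heq]; exact map_mem_fractionsIn _ _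
  -- The field is made a variable F' because the type of the adjunction depends on it, which blocks
  -- a direct rewrite.
  have ht : IntermediateField.adjoin F {ψ Polynomial.X} = ⊤ := by
    have h1 : ∀ F' : IntermediateField k L, F' = fractionsIn (constHom ψ) →
        IntermediateField.adjoin F' {ψ Polynomial.X} = ⊤ := by
      rintro _ rfl
      exact adjoin_X_eq_top hψ
    exact h1 _ heq
  have htr := transcendental_X hφ
  obtain ⟨a, b, c, d, habcd, hc | ⟨rfl, rfl, ha⟩⟩ :=
    exists_linearFractional_of_generators htr (adjoin_X_eq_top hφ) ht
  -- Case c ≠ 0: both lines are base changed to F, which contains A by definition and R by `heq`.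
  · exfalso
    let := fractionsInAlgebra (constHom φ)
    have := isFractionRing_fractionsIn (constHom_injective hφ.injective)
    let uR : R →+* F := ((constHom ψ).codRestrict F.toSubalgebra hαR).toRingHom
    let α : F[X] →+* L := eval₂RingHom (algebraMap F L) (φ Polynomial.X)
    let β : F[X] →+* L := eval₂RingHom (algebraMap F L) (ψ Polynomial.X)
    have hα : Function.Injective α := transcendental_iff_injective.mp htr
    have hαA : α.comp (mapRingHom (algebraMap A F)) = (φ : A[X] →+* L) := by
      apply Polynomial.ringHom_ext
      · intro x
        simp only [α, RingHom.comp_apply, coe_mapRingHom, map_C, coe_eval₂RingHom, eval₂_C]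
        rfl
      · simp [α]
    have hβR : β.comp (mapRingHom uR) = (ψ : R[X] →+* L) := by
      apply Polynomial.ringHom_ext
      · intro x
        simp only [β, RingHom.comp_apply, coe_mapRingHom, map_C, coe_eval₂RingHom, eval₂_C]
        rfl
      · simp [β]
    obtain ⟨g, hg⟩ := exists_projLine_extension (α := α) (β := β) (a := a) (b := b) (d := d)
      (φ := AffineSpace.map _ (Spec.map (CommRingCat.ofHom (algebraMap A F)) ≫ ι) ≫ C.φ)
      (ψ := AffineSpace.map _ (Spec.map (CommRingCat.ofHom uR) ≫ κ) ≫ D.φ) hα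
      (by ext; simp [α, β]) hc (by simpa [α, β] using habcd) (by
        rw [AffineSpace.map_comp, AffineSpace.map_comp, Category.assoc, Category.assoc,
          ← Category.assoc (affHom α), ← Category.assoc (affHom β), affHom_map, affHom_map, hαA, hβR,
          h])
    exact not_isVerticallyMaximal ι g hg hmax
  · classical
    obtain ⟨B, _, _, _, ε, α', ρ', hε, hα', hρ', hα'i, hρ'i, hs⟩ := exists_common_localization
      (constHom φ) (constHom ψ) (constHom_injective hφ.injective) (constHom_injective hψ.injective)
      -- Including a and its inverse makes s ↦ as + b invertible over B.
      heq {(a : L), (a : L)⁻¹, (b : L)} (by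
        intro x hx
        simp only [Finset.coe_insert, Finset.coe_singleton, Set.mem_insert_iff,
          Set.mem_singleton_iff] at hx
        rcases hx with rfl | rfl | rfl
        · exact a.2
        · exact inv_mem a.2
        · exact b.2)
    obtain ⟨a₀, ha₀⟩ := hs (show (a : L) ∈ _ by simp)
    obtain ⟨a₁, ha₁⟩ := hs (show (a : L)⁻¹ ∈ _ by simp)
    obtain ⟨b₀, hb₀⟩ := hs (show (b : L) ∈ _ by simp)
    have hau : IsUnit a₀ := by
      refine IsUnit.of_mul_eq_one a₁ (hε ?_)
      rw [map_mul, map_one]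
      change (ε : B →+* L) a₀ * (ε : B →+* L) a₁ = 1
      erw [ha₀, ha₁]
      exact mul_inv_cancel₀ (by simpa using ha)
    have h1 := hα'i.isOpenImmersion_specMap
    have h2 := hρ'i.isOpenImmersion_specMap
    let δ : B[X] →+* L := eval₂RingHom (ε : B →+* L) (φ Polynomial.X)
    let δ' : B[X] →+* L := eval₂RingHom (ε : B →+* L) (ψ Polynomial.X)
    have hδA : δ.comp (mapRingHom α'.toRingHom) = (φ : A[X] →+* L) := by
      apply Polynomial.ringHom_ext
      · intro x
        simp only [δ, RingHom.comp_apply, coe_mapRingHom, map_C, coe_eval₂RingHom, eval₂_C]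
        exact AlgHom.congr_fun hα' x
      · simp [δ]
    have hδR : δ'.comp (mapRingHom ρ'.toRingHom) = (ψ : R[X] →+* L) := by
      apply Polynomial.ringHom_ext
      · intro x
        simp only [δ', RingHom.comp_apply, coe_mapRingHom, map_C, coe_eval₂RingHom, eval₂_C]
        exact AlgHom.congr_fun hρ' x
      · simp [δ']
    refine equivalent_of_affine (L := L) (Spec.map (CommRingCat.ofHom α'.toRingHom) ≫ ι)
      (Spec.map (CommRingCat.ofHom ρ'.toRingHom) ≫ κ) ?_ ?_ δ δ' ?_ hau (b := b₀) ?_ ?_ ?_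
    · rw [Category.assoc, hι, ← Spec.map_comp, ← CommRingCat.ofHom_comp]
      exact congrArg (fun f => Spec.map (CommRingCat.ofHom f)) α'.comp_algebraMap
    · rw [Category.assoc, hκ, ← Spec.map_comp, ← CommRingCat.ofHom_comp]
      exact congrArg (fun f => Spec.map (CommRingCat.ofHom f)) ρ'.comp_algebraMap
    · ext; simp [δ, δ']
    · have h3 : ψ Polynomial.X = (a : L) * φ Polynomial.X + b := by simpa using habcd
      simp only [δ, δ', coe_eval₂RingHom, eval₂_X, eval₂_add, eval₂_mul, eval₂_C]
      rw [h3, ← ha₀, ← hb₀]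
      rfl
    · rw [AffineSpace.map_comp, AffineSpace.map_comp, Category.assoc, Category.assoc,
        ← Category.assoc (affHom δ), ← Category.assoc (affHom δ'), affHom_map, affHom_map, hδA, hδR,
        h]
    -- The dominant point of the line over Spec R factors through the open line over Spec B, so it
    -- is dominant there as well.
    · have h3 := isDominant_affHom hψ.injective
      rw [← hδR, ← affHom_map] at h3
      exact IsDominant.of_comp_of_isOpenImmersion _
        (AffineSpace.map PUnit.{u + 1} (Spec.map (CommRingCat.ofHom ρ'.toRingHom)))

end Cylinders.Cylinder

end

theorem mainTheorem4 (k : Type u) [Field k] [CharZero k]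
    (X : Scheme.{u}) (p : X ⟶ Spec (.of k)) (hp : Cylinders.IsVariety p) (hX : IrreducibleSpace X)
    (C : Cylinders.Cylinder p) (hmax : C.IsVerticallyMaximal)
    (huni : ¬ Cylinders.IsUniruled C.toBase) (D : Cylinders.Cylinder p) :
    D.Equivalent C := by
  have := hp.reduced
  have := hp.separated
  have := hp.locallyOfFiniteType
  have : AlgebraicGeometry.IsIntegral X := isIntegral_of_irreducibleSpace_of_isReduced X
  have : X.IsSeparated := by
    constructor
    rw [← terminal.comp_from p]
    infer_instance
  -- L takes its k-algebra structure from p, which makes the presentations from both cylinders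
  -- k-linear.
  obtain ⟨hk, hη⟩ := exists_algebra_of_affine p (A := X.functionField)
    (X.fromSpecStalk (genericPoint X))
  let : Algebra k X.functionField := hk
  obtain ⟨A, _, _, _, _, ι, φ, _, hι, hφ, hφη⟩ := Cylinders.Cylinder.exists_chart hη C
  obtain ⟨R, _, _, _, _, κ, ψ, _, hκ, hψ, hψη⟩ := Cylinders.Cylinder.exists_chart hη D
  rcases fractionsIn_eq_or_exists_prime hφ hψ with heq | ⟨P, _, hdim, β, hβ⟩
  · exact Cylinders.Cylinder.equivalent_of_fractionsIn_eq ι κ hι hκ hφ hψ (hφη.trans hψη.symm) heq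
      hmax
  · exact (huni (Cylinders.isUniruled_of_injective C.toBase ι hι hdim β hβ)).elim
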